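/- Let $n\ge 1$ and $p\in(1,\infty)$. On $\mathbb R^{n+1}=\mathbb R^n\times\mathbb R\ni(x,t)$ let $d((x,t),(y,s))=\max(|x-y|,|t-s|^{1/p})$ and let $|\cdot|$ be Lebesgue measure on sets. A (parabolic) cylinder is a ball $P=B_d(c,r)$, $r>0$; write $r(P)=r$, $\lambda P=B_d(c,\lambda r)$, $P\pm s$ for its translates by $\pm s$ in time, $P^{\pm}=P\pm 3r^p$, and $\widetilde P=\operatorname{conv}(P^+\cup P^-)$. Let $A=(A_1,A_2,A_3)\in[2,\infty)^3$. For an open set $\Omega\subset\mathbb R^{n+1}$ and cylinders $P,Q$, let $k_{\Omega,A}(P,Q)\in\mathbb N\cup\{\infty\}$ be the least $N\ge1$ for which there are cylinders $Q_1=P,Q_2,\dots,Q_N=Q$ such that $1/A_1\le |Q_{j+1}|/|Q_j|\le A_1$ and $|Q_j^+\cap Q_{j+1}^-|\ge \frac1{A_2}|Q_j\cup Q_{j+1}|$ for $1\le j<N$, and $\widetilde{A_3Q_j}\subset\Omega$ for $1\le j\le N$ (and $k_{\Omega,A}(P,Q)=\infty$ if there are none). For $t_0\in\mathbb R$ let $\Omega_{t_0}^{\pm}=\{(x,t)\in\Omega:\pm(t-t_0)>0\}$.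 An open set $\Omega$ is called a $(t_0,A)$-FIT Hölder domain if there are a cylinder $R_*\subset\Omega_{t_0}^-$ and a constant $K>0$ such that every $z\in\Omega_{t_0}^+$ satisfies the following two conditions: (i) there are a cylinder $Q\subset\Omega$ and $A'\in[2,\infty)^3$ with $z\in Q^+\subset\Omega_{t_0}^+$ and $k_{\Omega,A'}(R_*,Q)<\infty$; (ii) $$\inf\{k_{\Omega,A}(R_*,Q): Q\text{ a cylinder},\ z\in Q^+,\ Q\subset\Omega_{t_0}^+\}\le K\log_2\bigl(1+1/\operatorname{dist}_d(z,(\Omega_{t_0}^+)^c)\bigr).$$ **Lemma (outer layer decay).** Let $A\in[2,\infty)^3$, $t_0\in\mathbb R$, and let $\Omega$ be a $(t_0,A)$-FIT Hölder domain. Then there exist constants $D,\alpha>0$ such that for every integer $k\ge0$ the layer $$L_k=\{z\in\Omega_{t_0}^+: 2^{-k-1}<\operatorname{dist}_d(z,(\Omega_{t_0}^+)^c)\le 2^{-k}\}$$ satisfies $|L_k|\le D\,2^{-\alpha k}$. In addition, $|\Omega_{t_0}^+|<\infty$. -/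

import Mathlib

open MeasureTheory
open scoped ENNReal

noncomputable section

/-- Space time `ℝⁿ × ℝ`: the first component is the (Euclidean) space coordinate, the second is time.
Its `volume` is the `(n+1)`-dimensional Lebesgue measure. -/
abbrev SpaceTime (n : ℕ) : Type := EuclideanSpace ℝ (Fin n) × ℝ

/-- The parabolic distance `d(z,w) = max (|π_S(z-w)|, |π_T(z-w)|^{1/p})`. -/
def parabolicDist {n : ℕ} (p : ℝ) (z w : SpaceTime n) : ℝ :=
  max ‖z.1 - w.1‖ (|z.2 - w.2| ^ (1 / p))

/-- The parabolic distance from a point to a (nonempty) set. -/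
def parabolicInfDist {n : ℕ} (p : ℝ) (z : SpaceTime n) (S : Set (SpaceTime n)) : ℝ :=
  sInf ((fun w => parabolicDist p z w) '' S)

/-- The data (centre and radius) of a parabolic cylinder; the cylinder itself is `Cylinder.set`. -/
@[ext]
structure Cylinder (n : ℕ) where
  center : SpaceTime n
  radius : ℝ
  radius_pos : 0 < radius

namespace Cylinder

variable {n : ℕ}

/-- The point set of a parabolic cylinder: the ball `B_d(c,r)` of the parabolic distance. -/
def set (p : ℝ) (P : Cylinder n) : Set (SpaceTime n) :=
  {w | parabolicDist p w P.center < P.radius}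

/-- The time-lagged cylinder `P^{+,a} = P + a r(P)^p`; `P^{-,a}` is `P.lag p (-a)`. -/
def lag (p a : ℝ) (P : Cylinder n) : Cylinder n :=
  ⟨(P.center.1, P.center.2 + a * P.radius ^ p), P.radius, P.radius_pos⟩

/-- `P⁺ = P + 3 r(P)^p`. -/
def plus (p : ℝ) (P : Cylinder n) : Cylinder n := P.lag p 3

/-- `P⁻ = P - 3 r(P)^p`. -/
def minus (p : ℝ) (P : Cylinder n) : Cylinder n := P.lag p (-3)

/-- The dilate `l P`: same centre, radius multiplied by `l`. -/
def dilate (l : ℝ) (hl : 0 < l) (P : Cylinder n) : Cylinder n :=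
  ⟨P.center, l * P.radius, mul_pos hl P.radius_pos⟩

/-- `P̃^a`, the convex hull of `P^{+,a} ∪ P^{-,a}`. -/
def hull (p a : ℝ) (P : Cylinder n) : Set (SpaceTime n) :=
  convexHull ℝ ((P.lag p a).set p ∪ (P.lag p (-a)).set p)

end Cylinder

/-- `Ω_{t₀}^+`, the part of `Ω` after time `t₀`. -/
def futurePart {n : ℕ} (Ω : Set (SpaceTime n)) (t₀ : ℝ) : Set (SpaceTime n) :=
  {z | z ∈ Ω ∧ t₀ < z.2}

/-- `Ω_{t₀}^-`, the part of `Ω` before time `t₀`. -/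
def pastPart {n : ℕ} (Ω : Set (SpaceTime n)) (t₀ : ℝ) : Set (SpaceTime n) :=
  {z | z ∈ Ω ∧ z.2 < t₀}

/-- Forward-in-time links `(P,Q)` with parameters `A₁, A₂`. -/
def IsFITLink {n : ℕ} (p A₁ A₂ : ℝ) (P Q : Cylinder n) : Prop :=
  1 / A₁ ≤ volume.real (Q.set p) / volume.real (P.set p) ∧
  volume.real (Q.set p) / volume.real (P.set p) ≤ A₁ ∧
  1 / A₂ * volume.real (Q.set p ∪ P.set p) ≤
    volume.real ((P.plus p).set p ∩ (Q.minus p).set p)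

/-- The parameter set `[2,∞)³`; the entries `A 0, A 1, A 2` are `A₁, A₂, A₃`. -/
abbrev FITParam : Type := Fin 3 → Set.Ici (2 : ℝ)

lemma FITParam.pos (A : FITParam) (i : Fin 3) : 0 < (A i : ℝ) :=
  lt_of_lt_of_le two_pos (A i).2

/-- The family `C_{Ω,A}(P,Q)` of tuples `(Q_1,…,Q_N)` with `Q_1 = P` and `Q_N = Q`, whose consecutive
members form `FIT_{(A₁,A₂)}` links, and with `A₃ R̃³ ⊆ Ω` for each member `R`. Here `A₃ R̃³` is
the parabolic dilate, that is, the set `P̃³` of the dilated cylinder `P = A₃ R`. -/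
def fitChains {n : ℕ} (p : ℝ) (Ω : Set (SpaceTime n)) (A : FITParam) (P Q : Cylinder n) :
    Set (List (Cylinder n)) :=
  {C | C.head? = some P ∧ C.getLast? = some Q ∧
    C.IsChain (IsFITLink p (A 0) (A 1)) ∧
    ∀ R ∈ C, (R.dilate (A 2) (A.pos 2)).hull p 3 ⊆ Ω}

/-- The FIT distance `k_{Ω,A}(P,Q)`: the least number of members of a chain, `⊤` if there is none. -/
def fitDist {n : ℕ} (p : ℝ) (Ω : Set (SpaceTime n)) (A : FITParam) (P Q : Cylinder n) : ℕ∞ :=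
  ⨅ C ∈ fitChains p Ω A P Q, (C.length : ℕ∞)

/-- `Ω` is `t₀`-FIT connected with central cylinder `Rs`. -/
def IsFITConnectedWith {n : ℕ} (p t₀ : ℝ) (Ω : Set (SpaceTime n)) (Rs : Cylinder n) : Prop :=
  Rs.set p ⊆ pastPart Ω t₀ ∧
  ∀ z ∈ futurePart Ω t₀, ∃ (Q : Cylinder n) (A : FITParam),
    Q.set p ⊆ Ω ∧ z ∈ (Q.plus p).set p ∧ (Q.plus p).set p ⊆ futurePart Ω t₀ ∧
    fitDist p Ω A Rs Q < ⊤

/-- `(t₀,A)`-FIT Hölder domains. -/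
def IsFITHolder {n : ℕ} (p t₀ : ℝ) (A : FITParam) (Ω : Set (SpaceTime n)) : Prop :=
  IsOpen Ω ∧ ∃ Rs : Cylinder n, IsFITConnectedWith p t₀ Ω Rs ∧
    ∃ K : ℝ, 0 < K ∧ ∀ z ∈ futurePart Ω t₀,
      ((⨅ (Q : Cylinder n) (_ : z ∈ (Q.plus p).set p ∧ Q.set p ⊆ futurePart Ω t₀),
          fitDist p Ω A Rs Q : ℕ∞) : ℝ≥0∞) ≤
        ENNReal.ofReal (K * Real.logb 2 (1 + 1 / parabolicInfDist p z (futurePart Ω t₀)ᶜ))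

/-- The outer layer `L_k` of `Ω_{t₀}^+`. -/
def outerLayer {n : ℕ} (p t₀ : ℝ) (Ω : Set (SpaceTime n)) (k : ℕ) : Set (SpaceTime n) :=
  {z | z ∈ futurePart Ω t₀ ∧
    (2 : ℝ) ^ (-(k : ℤ) - 1) < parabolicInfDist p z (futurePart Ω t₀)ᶜ ∧
    parabolicInfDist p z (futurePart Ω t₀)ᶜ ≤ (2 : ℝ) ^ (-(k : ℤ))}

end

/-! The layer `L_k` is porous at a positive proportion of the scales `2⁻ⁱ`, `i < k`, and this forces
exponentially small measure.

Porosity. A point `z` of `L_k` is reached by a chain of at most `K (k + 2)` cylinders, which starts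
at a fixed size and ends at radius at most `2⁻ᵏ`, because the last radius is bounded by the distance
from `z` to the complement (`radius_le_parabolicInfDist`). At scale `2⁻ⁱ` consider the last member
of radius at least `2⁻ⁱ`. Each later radius contributes a geometric series to the sum over scales,
so outside a small proportion of scales the remaining tail has total length `O(2⁻ⁱ)`
(`exists_good_scales`), and that member lies within `O(2⁻ⁱ)` of `z`. Next to it is a ball of radius
`2⁻ⁱ` missing `L_k` (`chain_hole`): if the centre is after `t₀`, the hull condition puts a slightly
later cylinder deep inside the future part, at distance greater than `2⁻ᵏ` from its complement;
otherwise a slightly earlier cylinder lies before `t₀`.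

Measure. In nested partitions, discarding a hole costs a factor `θ < 1`, so points with many hole
scales are exponentially rare (`measure_many_holes_le`). The partitions are parabolic dyadic grids.
A point and its hole may be separated by one grid at every scale, but the one-third trick puts them
in a common cell of one of finitely many shifted grids (`exists_hasHole_gridIndex`), and by
pigeonhole one grid sees a fixed fraction of the holes.

The future part is not known in advance to be bounded. Chain radii are bounded (`chain_radius_le`),
so chain length only confines `L_k` to a box of side `O(k)`; the resulting polynomial factor is
absorbed by the exponential. Summing the layers, and boxing the points at distance more than `1`,
gives finite measure. -/

noncomputable section

/-! ### Holes in nested partitions of a measure space -/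

/-- A measure estimate on every cell of a countable measurable partition sums up to an estimate on
any measurable set. -/
lemma measure_le_of_forall_fiber {X ι : Type*} [MeasurableSpace X] [Countable ι] (μ : Measure X)
    (f : X → ι) (hf : ∀ a, MeasurableSet (f ⁻¹' {a})) (S T : Set X) (hT : MeasurableSet T)
    (t : ℝ≥0∞) (h : ∀ a, μ (S ∩ f ⁻¹' {a}) ≤ t * μ (T ∩ f ⁻¹' {a})) : μ S ≤ t * μ T := by
  have hu : (⋃ a, f ⁻¹' {a}) = Set.univ := by
    ext x; simp
  have hS : S = ⋃ a, S ∩ f ⁻¹' {a} := by rw [← Set.inter_iUnion, hu, Set.inter_univ]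
  have hT' : μ T = ∑' a, μ (T ∩ f ⁻¹' {a}) := by
    rw [← measure_iUnion, ← Set.inter_iUnion, hu, Set.inter_univ]
    · intro a b hab
      refine Set.disjoint_left.2 ?_
      rintro x ⟨-, hx⟩ ⟨-, hx'⟩
      exact hab (hx.symm.trans hx')
    · exact fun a => hT.inter (hf a)
  calc μ S ≤ ∑' a, μ (S ∩ f ⁻¹' {a}) := by
        conv_lhs => rw [hS]
        exact measure_iUnion_le _
    _ ≤ ∑' a, t * μ (T ∩ f ⁻¹' {a}) := ENNReal.tsum_le_tsum h
    _ = t * μ T := by rw [ENNReal.tsum_mul_left, hT']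

/-- The cell of `z` at level `l` of the partitions `κ` contains a cell of level `l + m` which is
disjoint from `L`. -/
def HasHole {X ι : Type*} (κ : ℕ → X → ι) (m : ℕ) (L : Set X) (l : ℕ) (z : X) : Prop :=
  ∃ w, κ l w = κ l z ∧ Disjoint (κ (l + m) ⁻¹' {κ (l + m) w}) L

lemma HasHole.congr {X ι : Type*} {κ : ℕ → X → ι} {m : ℕ} {L : Set X} {l : ℕ} {z w : X}
    (h : HasHole κ m L l z) (hzw : κ l z = κ l w) : HasHole κ m L l w := by
  obtain ⟨v, hv, hd⟩ := h
  exact ⟨v, hv.trans hzw, hd⟩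

lemma partition_eq_of_le {X ι : Type*} {κ : ℕ → X → ι}
    (hnest : ∀ i z w, κ (i + 1) z = κ (i + 1) w → κ i z = κ i w) {i l : ℕ} (hil : i ≤ l) {z w : X}
    (h : κ l z = κ l w) : κ i z = κ i w := by
  induction l, hil using Nat.le_induction with
  | base => exact h
  | succ l _ ih => exact ih (hnest _ _ _ h)

open scoped Classical in
/-- The points of `L` whose cells have holes at many levels form a set of small measure. -/
theorem measure_many_holes_le {X ι : Type*} [MeasurableSpace X] [Countable ι] (μ : Measure X)
    (κ : ℕ → X → ι) (hκ : ∀ i a, MeasurableSet (κ i ⁻¹' {a}))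
    (hnest : ∀ i z w, κ (i + 1) z = κ (i + 1) w → κ i z = κ i w)
    (hfin : ∀ i a, μ (κ i ⁻¹' {a}) < ⊤) (m : ℕ) (hm : 0 < m) (c θ : ℝ≥0∞) (hcθ : θ + c = 1)
    (hc : ∀ i z w, c * μ (κ i ⁻¹' {κ i z}) ≤ μ (κ (i + m) ⁻¹' {κ (i + m) w}))
    (L : Set X) (k d : ℕ) : ∀ (i j : ℕ), i + d = k → ∀ z,
    μ {w | w ∈ L ∧ κ i w = κ i z ∧ j * m ≤ {l ∈ Finset.Ico i k | HasHole κ m L l w}.card} ≤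
      θ ^ j * μ (κ i ⁻¹' {κ i z}) := by
  induction d using Nat.strong_induction_on with
  | _ d ih =>
  intro i j hid z
  rcases Nat.eq_zero_or_pos j with rfl | hj
  · simp only [pow_zero, one_mul]
    exact measure_mono fun w hw => hw.2.1
  obtain ⟨j, rfl⟩ : ∃ j', j = j' + 1 := ⟨j - 1, by omega⟩
  -- Fewer than `m` levels remain here, so `(j + 1) * m` hole levels are impossible.
  by_cases hlarge : k < i + m
  · have : {w | w ∈ L ∧ κ i w = κ i z ∧
        (j + 1) * m ≤ {l ∈ Finset.Ico i k | HasHole κ m L l w}.card} = ∅ := by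
      ext w
      simp only [Set.mem_ofPred_eq, Set.mem_empty_iff_false, iff_false, not_and, not_le]
      intro _ _
      refine (Finset.card_filter_le _ _).trans_lt ?_
      rw [Nat.card_Ico]
      nlinarith [Nat.sub_lt_left_of_lt_add (by omega : i ≤ k) hlarge]
    rw [this, measure_empty]
    exact bot_le
  -- At a hole, spend one factor `θ` and jump to level `i + m`. The skipped levels account for at
  -- most `m` hole levels, which is why holes are counted in multiples of `m`.
  by_cases hz : HasHole κ m L i z
  · obtain ⟨v, hv, hdisj⟩ := hz
    set T := κ i ⁻¹' {κ i z} \ κ (i + m) ⁻¹' {κ (i + m) v} with hTdef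
    have hsub : κ (i + m) ⁻¹' {κ (i + m) v} ⊆ κ i ⁻¹' {κ i z} := by
      intro w hw
      exact (partition_eq_of_le hnest (Nat.le_add_right i m) hw).trans hv
    have hTm : μ T ≤ θ * μ (κ i ⁻¹' {κ i z}) := by
      have hadd : μ (κ (i + m) ⁻¹' {κ (i + m) v}) + μ T = μ (κ i ⁻¹' {κ i z}) := by
        rw [hTdef, ← measure_union Set.disjoint_sdiff_right ((hκ _ _).diff (hκ _ _)),
          Set.union_sdiff_cancel hsub]
      have h1 : c * μ (κ i ⁻¹' {κ i z}) + μ T ≤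
          c * μ (κ i ⁻¹' {κ i z}) + θ * μ (κ i ⁻¹' {κ i z}) := by
        rw [← add_mul, add_comm c θ, hcθ, one_mul, ← hadd]
        gcongr
        rw [hadd]
        exact hc _ _ _
      refine (ENNReal.add_le_add_iff_left ?_).1 h1
      refine ENNReal.mul_ne_top (ne_top_of_le_ne_top ENNReal.one_ne_top ?_) (hfin _ _).ne
      rw [← hcθ]; exact le_add_self
    rw [pow_succ, mul_assoc]
    refine le_trans ?_ (mul_le_mul_right hTm _)
    refine measure_le_of_forall_fiber μ (κ (i + m)) (hκ _) _ T ((hκ _ _).diff (hκ _ _)) _ ?_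
    intro a
    by_cases hne : ({w | w ∈ L ∧ κ i w = κ i z ∧
        (j + 1) * m ≤ {l ∈ Finset.Ico i k | HasHole κ m L l w}.card} ∩ κ (i + m) ⁻¹' {a}).Nonempty
    · obtain ⟨u, ⟨huL, huz, hu⟩, rfl⟩ := hne
      have hTa : T ∩ κ (i + m) ⁻¹' {κ (i + m) u} = κ (i + m) ⁻¹' {κ (i + m) u} := by
        refine Set.inter_eq_right.2 fun w hw => ⟨?_, ?_⟩
        · exact (partition_eq_of_le hnest (Nat.le_add_right i m) hw).trans huz
        · intro hw'
          exact Set.disjoint_left.1 hdisj (show κ (i + m) u = κ (i + m) v from hw.symm.trans hw') huL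
      rw [hTa]
      refine le_trans (measure_mono ?_) (ih (d - m) (by omega) (i + m) j (by omega) u)
      rintro w ⟨⟨hwL, hwz, hw⟩, hwu⟩
      refine ⟨hwL, hwu, ?_⟩
      have hsplit : {l ∈ Finset.Ico i k | HasHole κ m L l w} ⊆
          Finset.Ico i (i + m) ∪ {l ∈ Finset.Ico (i + m) k | HasHole κ m L l w} := by
        intro l hl
        simp only [Finset.mem_filter, Finset.mem_Ico, Finset.mem_union] at hl ⊢
        have := hl.2
        by_cases h : l < i + m
        · left; omega
        · right; exact ⟨by omega, this⟩
      have := (Finset.card_le_card hsplit).trans (Finset.card_union_le _ _)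
      rw [Nat.card_Ico] at this
      rw [add_mul, one_mul] at hw
      have h3 : (j * m + m : ℕ) ≤ (i + m - i) + _ := hw.trans this
      omega
    · rw [Set.not_nonempty_iff_eq_empty] at hne
      rw [hne, measure_empty]
      exact bot_le
  -- Having a hole depends only on the cell, so level `i` contributes to no point of it and one can
  -- descend one level for free.
  · refine measure_le_of_forall_fiber μ (κ (i + 1)) (hκ _) _ _ (hκ _ _) _ ?_
    intro a
    by_cases hne : ({w | w ∈ L ∧ κ i w = κ i z ∧
        (j + 1) * m ≤ {l ∈ Finset.Ico i k | HasHole κ m L l w}.card} ∩ κ (i + 1) ⁻¹' {a}).Nonempty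
    · obtain ⟨u, ⟨huL, huz, hu⟩, rfl⟩ := hne
      have hTa : κ i ⁻¹' {κ i z} ∩ κ (i + 1) ⁻¹' {κ (i + 1) u} = κ (i + 1) ⁻¹' {κ (i + 1) u} := by
        refine Set.inter_eq_right.2 fun w hw => (hnest _ _ _ hw).trans huz
      rw [hTa]
      refine le_trans (measure_mono ?_) (ih (d - 1) (by omega) (i + 1) (j + 1) (by omega) u)
      rintro w ⟨⟨hwL, hwz, hw⟩, hwu⟩
      refine ⟨hwL, hwu, hw.trans (Finset.card_le_card ?_)⟩
      intro l hl
      simp only [Finset.mem_filter, Finset.mem_Ico] at hl ⊢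
      refine ⟨⟨?_, hl.1.2⟩, hl.2⟩
      refine Nat.succ_le_of_lt (hl.1.1.lt_of_ne ?_)
      rintro rfl
      exact hz (hl.2.congr hwz)
    · rw [Set.not_nonempty_iff_eq_empty] at hne
      rw [hne, measure_empty]
      exact bot_le

/-! ### Shifted parabolic dyadic grids -/

lemma floor_eq_floor_iff {x y : ℝ} : ⌊x⌋ = ⌊y⌋ ↔ ∀ m : ℤ, (m : ℝ) ≤ x ↔ (m : ℝ) ≤ y := by
  constructor
  · intro h m
    rw [← Int.le_floor, ← Int.le_floor, h]
  · intro h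
    exact le_antisymm (Int.le_floor.2 ((h _).1 (Int.floor_le x)))
      (Int.le_floor.2 ((h _).2 (Int.floor_le y)))

lemma floor_two_pow_mul_eq_of_le {a b : ℕ} (hab : a ≤ b) {x y : ℝ}
    (h : ⌊(2 : ℝ) ^ b * x⌋ = ⌊(2 : ℝ) ^ b * y⌋) : ⌊(2 : ℝ) ^ a * x⌋ = ⌊(2 : ℝ) ^ a * y⌋ := by
  obtain ⟨d, rfl⟩ := Nat.exists_eq_add_of_le hab
  rw [floor_eq_floor_iff] at h ⊢
  have key : ∀ (m : ℤ) (u : ℝ), ((m : ℝ) ≤ 2 ^ a * u ↔ ((m * 2 ^ d : ℤ) : ℝ) ≤ 2 ^ (a + d) * u) := by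
    intro m u
    have : (0 : ℝ) < 2 ^ d := by positivity
    push_cast
    rw [pow_add, mul_right_comm, mul_le_mul_iff_left₀ this]
  intro m
  rw [key, key]
  exact h _

/-- The two shifts `0` and `1/3` of the dyadic partition of the line. -/
def gridShift (b : Bool) : ℝ := if b then 1 / 3 else 0

lemma three_not_dvd_two_pow (b : ℕ) : ¬ (3 : ℤ) ∣ 2 ^ b := by
  intro h
  have := Int.prime_three.dvd_of_dvd_pow h
  omega

/-- The one-third trick: points which are close at scale `2⁻ᵇ` share a dyadic interval of length
`2⁻ᵇ` in one of the two shifted dyadic partitions. -/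
lemma exists_gridShift_floor_eq (b : ℕ) {x y : ℝ} (h : 3 * (2 ^ b * |x - y|) < 1) :
    ∃ s : Bool, ⌊(2 : ℝ) ^ b * (x - gridShift s)⌋ = ⌊(2 : ℝ) ^ b * (y - gridShift s)⌋ := by
  wlog hxy : x ≤ y generalizing x y
  · obtain ⟨s, hs⟩ := this (x := y) (y := x) (by rwa [abs_sub_comm]) (le_of_not_ge hxy)
    exact ⟨s, hs.symm⟩
  by_contra! hcon
  have h0 := hcon false
  have h1 := hcon true
  have hb : (0 : ℝ) < 2 ^ b := by positivity
  have key : ∀ s : ℝ, ⌊(2 : ℝ) ^ b * (x - s)⌋ ≠ ⌊(2 : ℝ) ^ b * (y - s)⌋ →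
      ∃ m : ℤ, 2 ^ b * (x - s) < m ∧ m ≤ 2 ^ b * (y - s) := by
    intro s hs
    refine ⟨⌊(2 : ℝ) ^ b * (y - s)⌋, ?_, Int.floor_le _⟩
    rw [← Int.floor_lt]
    exact lt_of_le_of_ne (Int.floor_mono (by gcongr)) hs
  obtain ⟨m, hm1, hm2⟩ := key _ h0
  obtain ⟨q, hq1, hq2⟩ := key _ h1
  simp only [gridShift, Bool.false_eq_true, if_false, if_true, sub_zero] at hm1 hm2 hq1 hq2
  rw [abs_sub_comm, abs_of_nonneg (sub_nonneg.2 hxy)] at h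
  -- If both grids separate `x` and `y`, then `m` and `q + 2 ^ b / 3` lie in the same interval of
  -- length less than `1/3`. This forces `3 (m - q) = 2 ^ b`.
  have e1 : |((3 * (m - q) - 2 ^ b : ℤ) : ℝ)| < 1 := by
    push_cast
    rw [abs_lt]
    constructor <;> nlinarith
  have e2 : |(3 * (m - q) - 2 ^ b : ℤ)| < 1 := by exact_mod_cast e1
  rw [Int.abs_lt_one_iff] at e2
  exact three_not_dvd_two_pow b ⟨m - q, by linarith⟩

/-- The index of the parabolic dyadic cell of level `i` containing `z`, in the partition shifted by
`σ`: space intervals have length `2⁻ⁱ` and time intervals have length about `2⁻ⁱᵖ`. -/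
def gridIndex {n : ℕ} (p : ℝ) (σ : (Fin n → Bool) × Bool) (i : ℕ) (z : SpaceTime n) :
    (Fin n → ℤ) × ℤ :=
  (fun l => ⌊(2 : ℝ) ^ i * (z.1 l - gridShift (σ.1 l))⌋,
    ⌊(2 : ℝ) ^ ⌊i * p⌋₊ * (z.2 - gridShift σ.2)⌋)

variable {n : ℕ}

/-- Rounding the time exponent down to an integer keeps the time grids dyadic, and `⌊i * p⌋₊` is
monotone in `i`. -/
lemma gridIndex_nested {p : ℝ} (hp : 0 ≤ p) (σ : (Fin n → Bool) × Bool) (i : ℕ) (z w : SpaceTime n)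
    (h : gridIndex p σ (i + 1) z = gridIndex p σ (i + 1) w) :
    gridIndex p σ i z = gridIndex p σ i w := by
  simp only [gridIndex, Prod.mk.injEq] at h ⊢
  refine ⟨?_, ?_⟩
  · funext l
    exact floor_two_pow_mul_eq_of_le (Nat.le_succ i) (congrFun h.1 l)
  · refine floor_two_pow_mul_eq_of_le ?_ h.2
    gcongr
    exact Nat.le_succ i

lemma floor_mul_sub_eq_iff (N : ℕ) (x s : ℝ) (a : ℤ) :
    ⌊(2 : ℝ) ^ N * (x - s)⌋ = a ↔
      x ∈ Set.Ico (a / 2 ^ N + s) (a / 2 ^ N + s + (2 ^ N)⁻¹) := by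
  have hN : (0 : ℝ) < 2 ^ N := by positivity
  rw [Int.floor_eq_iff, Set.mem_Ico, ← le_sub_iff_add_le, div_le_iff₀' hN]
  refine and_congr Iff.rfl ?_
  have e : (2 : ℝ) ^ N * (a / 2 ^ N + s + (2 ^ N)⁻¹) = a + 2 ^ N * s + 1 := by field_simp
  rw [← mul_lt_mul_iff_right₀ hN (b := x), e, mul_sub]
  constructor <;> intro h <;> linarith

lemma gridIndex_preimage (p : ℝ) (σ : (Fin n → Bool) × Bool) (i : ℕ) (a : (Fin n → ℤ) × ℤ) :
    gridIndex p σ i ⁻¹' {a} =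
      ((MeasurableEquiv.toLp 2 (Fin n → ℝ)).symm ⁻¹' Set.pi Set.univ fun l =>
        Set.Ico ((a.1 l : ℝ) / 2 ^ i + gridShift (σ.1 l))
          ((a.1 l : ℝ) / 2 ^ i + gridShift (σ.1 l) + (2 ^ i)⁻¹)) ×ˢ
      Set.Ico ((a.2 : ℝ) / 2 ^ ⌊i * p⌋₊ + gridShift σ.2)
          ((a.2 : ℝ) / 2 ^ ⌊i * p⌋₊ + gridShift σ.2 + (2 ^ ⌊i * p⌋₊)⁻¹) := by
  ext z
  simp only [Set.mem_preimage, Set.mem_singleton_iff, Set.mem_prod, Set.mem_pi, Set.mem_univ,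
    true_implies, ← floor_mul_sub_eq_iff, gridIndex, Prod.ext_iff, funext_iff]
  rfl

lemma measurableSet_gridIndex (p : ℝ) (σ : (Fin n → Bool) × Bool) (i : ℕ) (a : (Fin n → ℤ) × ℤ) :
    MeasurableSet (gridIndex p σ i ⁻¹' {a}) := by
  rw [gridIndex_preimage]
  refine MeasurableSet.prod ?_ measurableSet_Ico
  exact (MeasurableEquiv.measurable _) (MeasurableSet.univ_pi fun _ => measurableSet_Ico)

lemma volume_gridIndex (p : ℝ) (σ : (Fin n → Bool) × Bool) (i : ℕ) (a : (Fin n → ℤ) × ℤ) :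
    volume (gridIndex p σ i ⁻¹' {a}) = ENNReal.ofReal ((2 ^ (i * n + ⌊i * p⌋₊))⁻¹) := by
  rw [gridIndex_preimage, Measure.volume_eq_prod, Measure.prod_prod,
    (EuclideanSpace.volume_preserving_symm_measurableEquiv_toLp (Fin n)).measure_preimage
      (MeasurableSet.univ_pi fun _ => measurableSet_Ico).nullMeasurableSet,
    Real.volume_pi_Ico, Real.volume_Ico]
  simp only [add_sub_cancel_left, Finset.prod_const, Finset.card_univ, Fintype.card_fin]
  rw [← ENNReal.ofReal_pow (by positivity), ← ENNReal.ofReal_mul (by positivity), pow_add, mul_inv,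
    pow_mul, inv_pow]

lemma abs_sub_lt_of_floor_eq {N : ℕ} {x y s : ℝ}
    (h : ⌊(2 : ℝ) ^ N * (x - s)⌋ = ⌊(2 : ℝ) ^ N * (y - s)⌋) : |x - y| < (2 ^ N)⁻¹ := by
  have hN : (0 : ℝ) < 2 ^ N := by positivity
  have := Int.abs_sub_lt_one_of_floor_eq_floor h
  rw [← mul_sub, sub_sub_sub_cancel_right, abs_mul, abs_of_pos hN] at this
  rwa [← one_div, lt_div_iff₀' hN]

lemma norm_lt_of_forall_abs_lt {n : ℕ} (v : EuclideanSpace ℝ (Fin n)) {δ N : ℝ} (hδ : 0 < δ)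
    (hN : (n : ℝ) < N) (h : ∀ l, |v l| ≤ δ) : ‖v‖ < N * δ := by
  have h1 : ‖v‖ ^ 2 ≤ (n * δ) ^ 2 := by
    rw [EuclideanSpace.norm_sq_eq]
    calc ∑ l, ‖v l‖ ^ 2 ≤ ∑ _l : Fin n, δ ^ 2 :=
          Finset.sum_le_sum fun l _ => pow_le_pow_left₀ (norm_nonneg _) (h l) 2
      _ = n * δ ^ 2 := by simp
      _ ≤ (n * δ) ^ 2 := by
          have : (n : ℝ) ≤ n ^ 2 := by exact_mod_cast Nat.le_self_pow two_ne_zero n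
          rw [mul_pow]
          gcongr
  have h2 : ‖v‖ ≤ n * δ := le_of_sq_le_sq h1 (by positivity)
  exact h2.trans_lt (by gcongr)

lemma inv_two_pow_rpow (i : ℕ) (p : ℝ) : ((2 : ℝ) ^ i)⁻¹ ^ p = 2 ^ (-(i * p)) := by
  rw [Real.inv_rpow (by positivity), ← Real.rpow_natCast, ← Real.rpow_mul zero_le_two,
    ← Real.rpow_neg zero_le_two]

/-- Going up `a` levels, with `2 ^ a > 3 C`, makes `z` and the centre `h` close enough for the
one-third trick in each coordinate. Going down to level `i + n + 1` makes the cell of `h` fit into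
the ball of radius `2⁻ⁱ`. -/
lemma exists_hasHole_gridIndex (n : ℕ) {p : ℝ} (hp : 1 ≤ p) (C : ℝ) :
    ∃ a m : ℕ, 0 < m ∧ ∀ (L : Set (SpaceTime n)) (i : ℕ) (z h : SpaceTime n), a ≤ i →
      ‖z.1 - h.1‖ ≤ C * ((2 : ℝ) ^ i)⁻¹ → |z.2 - h.2| ≤ C * ((2 : ℝ) ^ i)⁻¹ ^ p →
      (∀ w : SpaceTime n, ‖w.1 - h.1‖ < ((2 : ℝ) ^ i)⁻¹ → |w.2 - h.2| < ((2 : ℝ) ^ i)⁻¹ ^ p →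
        w ∉ L) →
      ∃ σ, HasHole (gridIndex p σ) m L (i - a) z := by
  have hp0 : 0 ≤ p := zero_le_one.trans hp
  wlog hC : 0 < C generalizing C
  · obtain ⟨a, m, hm, H⟩ := this 1 one_pos
    refine ⟨a, m, hm, fun L i z h hi h1 h2 h3 => H L i z h hi (h1.trans ?_) (h2.trans ?_) h3⟩
    · gcongr; linarith
    · gcongr; linarith
  obtain ⟨a, ha⟩ := pow_unbounded_of_one_lt (3 * C) one_lt_two
  refine ⟨a, a + (n + 1), by omega, ?_⟩
  intro L i z h hai hz1 hz2 hL
  obtain ⟨b, rfl⟩ := Nat.exists_eq_add_of_le hai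
  have h2a : (0 : ℝ) < 2 ^ a := by positivity
  have h2b : (0 : ℝ) < 2 ^ b := by positivity
  have hx : ∀ l, ∃ s, ⌊(2 : ℝ) ^ b * (h.1 l - gridShift s)⌋ = ⌊(2 : ℝ) ^ b * (z.1 l - gridShift s)⌋ := by
    intro l
    refine exists_gridShift_floor_eq b ?_
    have h1 : |h.1 l - z.1 l| ≤ C * (2 ^ (a + b))⁻¹ := by
      rw [abs_sub_comm]
      exact (PiLp.norm_apply_le (z.1 - h.1) l).trans hz1
    calc 3 * (2 ^ b * |h.1 l - z.1 l|) ≤ 3 * (2 ^ b * (C * (2 ^ (a + b))⁻¹)) := by gcongr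
      _ = 3 * C / 2 ^ a := by rw [pow_add]; field_simp
      _ < 1 := by rwa [div_lt_one h2a]
  have ht : ∃ s, ⌊(2 : ℝ) ^ ⌊b * p⌋₊ * (h.2 - gridShift s)⌋ =
      ⌊(2 : ℝ) ^ ⌊b * p⌋₊ * (z.2 - gridShift s)⌋ := by
    refine exists_gridShift_floor_eq _ ?_
    rw [abs_sub_comm]
    calc 3 * ((2 : ℝ) ^ ⌊b * p⌋₊ * |z.2 - h.2|)
        ≤ 3 * ((2 : ℝ) ^ (b * p) * (C * 2 ^ (-(((a + b : ℕ) : ℝ) * p)))) := by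
          rw [← inv_two_pow_rpow, ← Real.rpow_natCast 2 ⌊b * p⌋₊]
          gcongr
          · exact one_le_two
          · exact Nat.floor_le (by positivity)
      _ = 3 * C * 2 ^ (-(a * p)) := by
          have : -((a : ℝ) * p) = b * p + -(((a + b : ℕ) : ℝ) * p) := by push_cast; ring
          rw [this, Real.rpow_add two_pos]
          ring
      _ ≤ 3 * C * 2 ^ (-(a : ℝ)) := by
          gcongr
          · exact one_le_two
          · exact le_mul_of_one_le_right (Nat.cast_nonneg _) hp
      _ = 3 * C / 2 ^ a := by rw [Real.rpow_neg zero_le_two, Real.rpow_natCast, div_eq_mul_inv]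
      _ < 1 := by rwa [div_lt_one h2a]
  choose s hs using hx
  obtain ⟨s', hs'⟩ := ht
  refine ⟨(s, s'), h, ?_, ?_⟩
  · rw [Nat.add_sub_cancel_left]
    exact Prod.ext (funext hs) hs'
  · refine Set.disjoint_left.2 fun w hw => ?_
    have hlev : a + b - a + (a + (n + 1)) = a + b + (n + 1) := by omega
    rw [hlev] at hw
    have hw' := Prod.ext_iff.1 hw
    apply hL w
    · have := norm_lt_of_forall_abs_lt (w.1 - h.1) (δ := (2 ^ (a + b + (n + 1)))⁻¹)
        (N := 2 ^ (n + 1)) (by positivity) ?_ fun l => (abs_sub_lt_of_floor_eq (congrFun hw'.1 l)).le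
      · refine this.trans_eq ?_
        rw [pow_add _ (a + b)]
        field_simp
      · exact_mod_cast Nat.lt_two_pow_self.trans (Nat.pow_lt_pow_right one_lt_two n.lt_succ_self)
    · refine (abs_sub_lt_of_floor_eq hw'.2).trans_le ?_
      rw [inv_two_pow_rpow, ← Real.rpow_natCast, ← Real.rpow_neg zero_le_two]
      refine Real.rpow_le_rpow_of_exponent_le one_le_two (neg_le_neg ?_)
      have h1 := (Nat.lt_floor_add_one (((a + b + (n + 1) : ℕ) : ℝ) * p)).le
      push_cast at h1 ⊢
      nlinarith [mul_nonneg (Nat.cast_nonneg (α := ℝ) n) hp0]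

/-- Every cell of level `i + m` occupies a definite portion of a cell of level `i`. -/
lemma exists_volume_gridIndex_ratio (n : ℕ) (p : ℝ) (m : ℕ) :
    ∃ c : ℝ, 0 < c ∧ c ≤ 1 ∧ ∀ (σ : (Fin n → Bool) × Bool) (i : ℕ) (a b : (Fin n → ℤ) × ℤ),
      ENNReal.ofReal c * volume (gridIndex p σ i ⁻¹' {a}) ≤
        volume (gridIndex p σ (i + m) ⁻¹' {b}) := by
  refine ⟨(2 ^ (m * n + (⌊m * p⌋₊ + 2)))⁻¹, by positivity, inv_le_one_of_one_le₀ ?_, ?_⟩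
  · exact one_le_pow₀ one_le_two
  intro σ i a b
  rw [volume_gridIndex, volume_gridIndex, ← ENNReal.ofReal_mul (by positivity), ← mul_inv,
    ← pow_add]
  refine ENNReal.ofReal_le_ofReal (inv_anti₀ (by positivity) (pow_le_pow_right₀ one_le_two ?_))
  have : ⌊((i + m : ℕ) : ℝ) * p⌋₊ ≤ ⌊i * p⌋₊ + ⌊m * p⌋₊ + 2 := by
    have h1 := Nat.lt_floor_add_one (i * p)
    have h2 := Nat.lt_floor_add_one (m * p)
    refine Nat.floor_le_of_le ?_
    push_cast
    linarith
  rw [add_mul]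
  omega

lemma volume_setOf_abs_le (n : ℕ) (M : ℝ) :
    MeasurableSet {z : SpaceTime n | (∀ l, |z.1 l| ≤ M) ∧ |z.2| ≤ M} ∧
    volume {z : SpaceTime n | (∀ l, |z.1 l| ≤ M) ∧ |z.2| ≤ M} = ENNReal.ofReal (2 * M) ^ (n + 1) := by
  have h : {z : SpaceTime n | (∀ l, |z.1 l| ≤ M) ∧ |z.2| ≤ M} =
      ((MeasurableEquiv.toLp 2 (Fin n → ℝ)).symm ⁻¹' Set.pi Set.univ fun _ =>
        Set.Icc (-M) M) ×ˢ Set.Icc (-M) M := by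
    ext z
    simp only [Set.mem_prod, Set.mem_preimage, Set.mem_pi, Set.mem_univ, true_implies, Set.mem_Icc,
      ← abs_le]
    rfl
  have hm : MeasurableSet (Set.pi Set.univ fun _ : Fin n => Set.Icc (-M) M) :=
    MeasurableSet.univ_pi fun _ => measurableSet_Icc
  rw [h]
  refine ⟨((MeasurableEquiv.measurable _) hm).prod measurableSet_Icc, ?_⟩
  rw [Measure.volume_eq_prod, Measure.prod_prod,
    (EuclideanSpace.volume_preserving_symm_measurableEquiv_toLp (Fin n)).measure_preimage
      hm.nullMeasurableSet, Real.volume_Icc, volume_pi_pi]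
  simp only [Real.volume_Icc, Finset.prod_const, Finset.card_univ, Fintype.card_fin]
  rw [pow_succ]
  ring_nf

open scoped Classical in
/-- The points of a bounded set whose dyadic cells have holes at many levels form a set of
exponentially small measure. -/
theorem exists_volume_many_holes_le (n : ℕ) {p : ℝ} (hp : 0 ≤ p) (m : ℕ) (hm : 0 < m) :
    ∃ θ : ℝ, 0 ≤ θ ∧ θ < 1 ∧ ∀ (σ : (Fin n → Bool) × Bool) (L : Set (SpaceTime n)) (M : ℝ)
      (k j : ℕ), (∀ z ∈ L, (∀ l, |z.1 l| ≤ M) ∧ |z.2| ≤ M) →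
      volume {z | z ∈ L ∧
        j * m ≤ {l ∈ Finset.Ico 0 k | HasHole (gridIndex p σ) m L l z}.card} ≤
      ENNReal.ofReal θ ^ j * ENNReal.ofReal (2 * (M + 1)) ^ (n + 1) := by
  obtain ⟨c, hc0, hc1, hc⟩ := exists_volume_gridIndex_ratio n p m
  refine ⟨1 - c, by linarith, by linarith, ?_⟩
  intro σ L M k j hL
  rw [← (volume_setOf_abs_le n (M + 1)).2]
  refine measure_le_of_forall_fiber volume (gridIndex p σ 0) (measurableSet_gridIndex p σ 0) _ _
    (volume_setOf_abs_le n (M + 1)).1 _ ?_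
  intro a
  by_cases hne : ({z | z ∈ L ∧
        j * m ≤ {l ∈ Finset.Ico 0 k | HasHole (gridIndex p σ) m L l z}.card} ∩
        gridIndex p σ 0 ⁻¹' {a}).Nonempty
  · obtain ⟨u, ⟨huL, hu⟩, rfl⟩ := hne
    -- Cells of level `0` have unit sides, so a cell meeting `L` stays in the box enlarged by `1`.
    have hsub : {z : SpaceTime n | (∀ l, |z.1 l| ≤ M + 1) ∧ |z.2| ≤ M + 1} ∩
        gridIndex p σ 0 ⁻¹' {gridIndex p σ 0 u} = gridIndex p σ 0 ⁻¹' {gridIndex p σ 0 u} := by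
      refine Set.inter_eq_right.2 fun w hw => ?_
      have hw' := Prod.ext_iff.1 hw
      refine ⟨fun l => ?_, ?_⟩
      · have h1 := abs_sub_lt_of_floor_eq (congrFun hw'.1 l)
        have h2 := (hL u huL).1 l
        have h3 := abs_sub_abs_le_abs_sub (w.1 l) (u.1 l)
        norm_num at h1
        linarith
      · have h1 := abs_sub_lt_of_floor_eq hw'.2
        have h2 := (hL u huL).2
        have h3 := abs_sub_abs_le_abs_sub w.2 u.2
        norm_num at h1
        linarith
    rw [hsub]
    refine le_trans (measure_mono ?_) (measure_many_holes_le volume (gridIndex p σ)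
      (measurableSet_gridIndex p σ) (gridIndex_nested hp σ) ?_ m hm (ENNReal.ofReal c)
      (ENNReal.ofReal (1 - c)) ?_ (fun i z w => hc σ i _ _) L k k 0 j (zero_add k) u)
    · rintro w ⟨⟨hwL, hw⟩, hwu⟩
      exact ⟨hwL, hwu, hw⟩
    · intro i a
      rw [volume_gridIndex]
      exact ENNReal.ofReal_lt_top
    · rw [← ENNReal.ofReal_add (by linarith) hc0.le]
      simp
  · rw [Set.not_nonempty_iff_eq_empty] at hne
    rw [hne, measure_empty]
    exact bot_le

/-! ### Cylinders and links -/

lemma parabolicDist_lt_iff {p : ℝ} (hp : 0 < p) (z w : SpaceTime n) {r : ℝ} (hr : 0 < r) :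
    parabolicDist p z w < r ↔ ‖z.1 - w.1‖ < r ∧ |z.2 - w.2| < r ^ p := by
  rw [parabolicDist, max_lt_iff, one_div, Real.rpow_inv_lt_iff_of_pos (abs_nonneg _) hr.le hp]

lemma Cylinder.mem_set_iff {p : ℝ} (hp : 0 < p) (P : Cylinder n) (w : SpaceTime n) :
    w ∈ P.set p ↔ ‖w.1 - P.center.1‖ < P.radius ∧ |w.2 - P.center.2| < P.radius ^ p :=
  parabolicDist_lt_iff hp _ _ P.radius_pos

lemma Cylinder.volume_set {p : ℝ} (hp : 0 < p) (P : Cylinder n) :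
    volume (P.set p) = ENNReal.ofReal (P.radius ^ n * P.radius ^ p) *
      (2 * volume (Metric.ball (0 : EuclideanSpace ℝ (Fin n)) 1)) := by
  have h : P.set p = Metric.ball P.center.1 P.radius ×ˢ Metric.ball P.center.2 (P.radius ^ p) := by
    ext w
    rw [P.mem_set_iff hp, Set.mem_prod, Metric.mem_ball, Metric.mem_ball, dist_eq_norm,
      Real.dist_eq]
  have hr := P.radius_pos
  rw [h, Measure.volume_eq_prod, Measure.prod_prod, Measure.addHaar_ball_of_pos _ _ hr,
    Real.volume_ball, ENNReal.ofReal_mul zero_le_two, ENNReal.ofReal_mul (by positivity),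
    finrank_euclideanSpace_fin, ENNReal.ofReal_ofNat]
  ring

lemma Cylinder.volume_set_lt_top {p : ℝ} (hp : 0 < p) (P : Cylinder n) :
    volume (P.set p) < ⊤ := by
  rw [P.volume_set hp]
  exact ENNReal.mul_lt_top ENNReal.ofReal_lt_top
    (ENNReal.mul_lt_top ENNReal.ofNat_lt_top Metric.isBounded_ball.measure_lt_top)

lemma Cylinder.volume_real_set {p : ℝ} (hp : 0 < p) (P : Cylinder n) :
    volume.real (P.set p) = P.radius ^ n * P.radius ^ p *
      (2 * volume.real (Metric.ball (0 : EuclideanSpace ℝ (Fin n)) 1)) := by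
  have hr := P.radius_pos
  rw [measureReal_def, P.volume_set hp, ENNReal.toReal_mul, ENNReal.toReal_mul,
    ENNReal.toReal_ofReal (by positivity), measureReal_def]
  rfl

lemma volume_real_unit_ball_pos :
    0 < volume.real (Metric.ball (0 : EuclideanSpace ℝ (Fin n)) 1) :=
  ENNReal.toReal_pos (Metric.measure_ball_pos _ _ one_pos).ne'
    Metric.isBounded_ball.measure_lt_top.ne

lemma Cylinder.volume_real_set_pos {p : ℝ} (hp : 0 < p) (P : Cylinder n) :
    0 < volume.real (P.set p) := by
  have hr := P.radius_pos
  have := volume_real_unit_ball_pos (n := n)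
  rw [P.volume_real_set hp]
  positivity

section Link

variable {p A₁ A₂ : ℝ} {P Q : Cylinder n}

/-- Volume scales like `r ^ n * r ^ p`. Since `p ≥ 1`, the time factor alone would exceed the
allowed ratio `A₁` if the radius shrank by more than `A₁`. -/
lemma IsFITLink.radius_le (hp : 1 ≤ p) (hA : 1 ≤ A₁) (h : IsFITLink p A₁ A₂ P Q) :
    P.radius ≤ A₁ * Q.radius := by
  have hp0 : 0 < p := by linarith
  have hP := P.radius_pos
  have hQ := Q.radius_pos
  have hV := volume_real_unit_ball_pos (n := n)
  have h1 := h.1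
  rw [div_le_div_iff₀ (by linarith) (P.volume_real_set_pos hp0), one_mul, P.volume_real_set hp0,
    Q.volume_real_set hp0] at h1
  have h2 : P.radius ^ n * P.radius ^ p ≤ Q.radius ^ n * Q.radius ^ p * A₁ := by
    have h3 : 0 < 2 * volume.real (Metric.ball (0 : EuclideanSpace ℝ (Fin n)) 1) := by positivity
    rw [mul_right_comm (Q.radius ^ n * Q.radius ^ p)] at h1
    exact le_of_mul_le_mul_right h1 h3
  by_contra! hcon
  have h4 : Q.radius ^ n ≤ P.radius ^ n := pow_le_pow_left₀ hQ.le (by nlinarith) n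
  have h5 : A₁ * Q.radius ^ p < P.radius ^ p := by
    calc A₁ * Q.radius ^ p ≤ A₁ ^ p * Q.radius ^ p := by
          gcongr
          exact Real.self_le_rpow_of_one_le hA hp
      _ = (A₁ * Q.radius) ^ p := (Real.mul_rpow (by linarith) hQ.le).symm
      _ < P.radius ^ p := Real.rpow_lt_rpow (by positivity) hcon hp0
  have h6 : 0 < Q.radius ^ n := by positivity
  have h7 : 0 < P.radius ^ p := by positivity
  nlinarith

lemma IsFITLink.nonempty (hp : 0 < p) (hA : 0 < A₂) (h : IsFITLink p A₁ A₂ P Q) :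
    ((P.plus p).set p ∩ (Q.minus p).set p).Nonempty := by
  rw [Set.nonempty_iff_ne_empty]
  intro he
  have h1 := h.2.2
  rw [he, measureReal_empty] at h1
  have h2 : 0 < volume.real (Q.set p ∪ P.set p) :=
    (Q.volume_real_set_pos hp).trans_le (measureReal_mono Set.subset_union_left
      (measure_union_lt_top (Q.volume_set_lt_top hp) (P.volume_set_lt_top hp)).ne)
  have : 0 < 1 / A₂ * volume.real (Q.set p ∪ P.set p) := by positivity
  linarith

/-- A common point of `P⁺` and `Q⁻` lies between 2 and 4 units of `r ^ p` after the centre of `P`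
and before that of `Q`. Hence time strictly advances along a chain. -/
lemma IsFITLink.bounds (hp : 0 < p) (hA : 0 < A₂) (h : IsFITLink p A₁ A₂ P Q) :
    ‖P.center.1 - Q.center.1‖ ≤ P.radius + Q.radius ∧
    2 * (P.radius ^ p + Q.radius ^ p) ≤ Q.center.2 - P.center.2 ∧
    Q.center.2 - P.center.2 ≤ 4 * (P.radius ^ p + Q.radius ^ p) := by
  obtain ⟨w, hw1, hw2⟩ := h.nonempty hp hA
  rw [Cylinder.mem_set_iff hp] at hw1 hw2
  obtain ⟨a1, a2⟩ := hw1
  obtain ⟨b1, b2⟩ := hw2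
  simp only [Cylinder.plus, Cylinder.minus, Cylinder.lag, abs_lt] at a1 a2 b1 b2
  refine ⟨?_, by linarith, by linarith⟩
  rw [norm_sub_rev] at a1
  have := norm_sub_le_norm_sub_add_norm_sub P.center.1 w.1 Q.center.1
  linarith

end Link

lemma Cylinder.subset_hull_dilate {p l : ℝ} (hp : 1 ≤ p) (hl : 2 ≤ l) (hl0 : 0 < l)
    (R : Cylinder n) (w : SpaceTime n) (h1 : ‖w.1 - R.center.1‖ < 2 * R.radius)
    (h2 : |w.2 - R.center.2| < 8 * R.radius ^ p) : w ∈ (R.dilate l hl0).hull p 3 := by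
  have hp0 : 0 < p := by linarith
  have hr := R.radius_pos
  set ρ := l * R.radius with hρ
  have hρ0 : 0 < ρ := by positivity
  have h1' : ‖w.1 - R.center.1‖ < ρ := h1.trans_le (mul_le_mul_of_nonneg_right hl hr.le)
  have h2' : |w.2 - R.center.2| < 4 * ρ ^ p := by
    refine h2.trans_le ?_
    have : 2 ≤ l ^ p := hl.trans (Real.self_le_rpow_of_one_le (by linarith) hp)
    have h3 : 0 < R.radius ^ p := by positivity
    rw [hρ, Real.mul_rpow hl0.le hr.le]
    nlinarith
  have hρp : 0 < ρ ^ p := by positivity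
  -- The point lies on a vertical segment with endpoints at height `± s`; clamping `s` to `[3 ρ ^ p,
  -- 4 ρ ^ p)` puts these endpoints in the two lagged cylinders.
  set s := max |w.2 - R.center.2| (3 * ρ ^ p) with hs
  have hs1 : |w.2 - R.center.2| ≤ s := le_max_left _ _
  have hs2 : 3 * ρ ^ p ≤ s := le_max_right _ _
  have hs3 : s < 4 * ρ ^ p := max_lt h2' (by linarith)
  have htop : ((w.1, R.center.2 + s) : SpaceTime n) ∈ ((R.dilate l hl0).lag p 3).set p := by
    rw [Cylinder.mem_set_iff hp0]
    refine ⟨h1', ?_⟩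
    change |R.center.2 + s - (R.center.2 + 3 * ρ ^ p)| < ρ ^ p
    rw [abs_lt]
    constructor <;> linarith
  have hbot : ((w.1, R.center.2 - s) : SpaceTime n) ∈ ((R.dilate l hl0).lag p (-3)).set p := by
    rw [Cylinder.mem_set_iff hp0]
    refine ⟨h1', ?_⟩
    change |R.center.2 - s - (R.center.2 + -3 * ρ ^ p)| < ρ ^ p
    rw [abs_lt]
    constructor <;> linarith
  rw [abs_le] at hs1
  have hs0 : 0 < s := by linarith
  have hseg : w ∈ segment ℝ ((w.1, R.center.2 + s) : SpaceTime n) (w.1, R.center.2 - s) := by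
    refine ⟨(s + (w.2 - R.center.2)) / (2 * s), (s - (w.2 - R.center.2)) / (2 * s),
      div_nonneg (by linarith) (by linarith), div_nonneg (by linarith) (by linarith), ?_, ?_⟩
    · field_simp
      ring
    · refine Prod.ext ?_ ?_
      · simp only [Prod.smul_mk, Prod.mk_add_mk]
        rw [← add_smul, ← add_div]
        convert one_smul ℝ w.1
        field_simp
        ring
      · simp only [Prod.smul_mk, Prod.mk_add_mk, smul_eq_mul]
        field_simp
        ring
  rw [Cylinder.hull]
  exact (convex_convexHull ℝ _).segment_subset (subset_convexHull ℝ _ (Set.mem_union_left _ htop))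
    (subset_convexHull ℝ _ (Set.mem_union_right _ hbot)) hseg

/-! ### Cylinders far from, or outside, the future part -/

lemma le_parabolicInfDist_compl {p : ℝ} (hp : 0 < p) {S : Set (SpaceTime n)} (hS : Sᶜ.Nonempty)
    {z : SpaceTime n} {r : ℝ} (hr : 0 < r)
    (h : ∀ v : SpaceTime n, ‖v.1 - z.1‖ < r → |v.2 - z.2| < r ^ p → v ∈ S) :
    r ≤ parabolicInfDist p z Sᶜ := by
  -- Nonemptiness matters: the real infimum of the empty set is `0`.
  refine le_csInf (hS.image _) ?_
  rintro _ ⟨v, hv, rfl⟩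
  by_contra! hcon
  obtain ⟨h1, h2⟩ := (parabolicDist_lt_iff hp z v hr).1 hcon
  rw [norm_sub_rev] at h1
  rw [abs_sub_comm] at h2
  exact hv (h v h1 h2)

lemma futurePart_compl_nonempty (Ω : Set (SpaceTime n)) (t₀ : ℝ) : (futurePart Ω t₀)ᶜ.Nonempty :=
  ⟨(0, t₀), fun h => lt_irrefl _ h.2⟩

section Hole

variable {p t₀ : ℝ} {A : FITParam} {Ω : Set (SpaceTime n)} {R : Cylinder n}

lemma mem_futurePart_of_above (hp : 1 ≤ p)
    (hR : (R.dilate (A 2) (A.pos 2)).hull p 3 ⊆ Ω) (ht : t₀ < R.center.2) {v : SpaceTime n}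
    (h1 : ‖v.1 - R.center.1‖ < 2 * R.radius) (h2 : R.center.2 ≤ v.2)
    (h3 : v.2 < R.center.2 + 8 * R.radius ^ p) : v ∈ futurePart Ω t₀ := by
  refine ⟨hR (R.subset_hull_dilate hp (A 2).2 (A.pos 2) v h1 ?_), ht.trans_le h2⟩
  rw [abs_lt]
  constructor <;> linarith [Real.rpow_nonneg R.radius_pos.le p]

/-- A cylinder of a chain whose centre lies after `t₀` has, slightly later, a cylinder of the same
size far from the boundary of the future part. -/
lemma hole_of_center_gt (hp : 1 ≤ p)
    (hR : (R.dilate (A 2) (A.pos 2)).hull p 3 ⊆ Ω) (ht : t₀ < R.center.2) {w : SpaceTime n}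
    (h1 : ‖w.1 - R.center.1‖ < R.radius)
    (h2 : |w.2 - (R.center.2 + 2 * R.radius ^ p)| < R.radius ^ p) :
    w ∈ futurePart Ω t₀ ∧ R.radius ≤ parabolicInfDist p w (futurePart Ω t₀)ᶜ := by
  have hr := R.radius_pos
  rw [abs_lt] at h2
  constructor
  · apply mem_futurePart_of_above hp hR ht <;> linarith
  · refine le_parabolicInfDist_compl (by linarith) (futurePart_compl_nonempty Ω t₀) hr ?_
    intro v hv1 hv2
    rw [abs_lt] at hv2
    have := norm_sub_le_norm_sub_add_norm_sub v.1 w.1 R.center.1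
    apply mem_futurePart_of_above hp hR ht <;> linarith

lemma hole_of_center_le (ht : R.center.2 ≤ t₀) {w : SpaceTime n}
    (h2 : |w.2 - (R.center.2 - 2 * R.radius ^ p)| < R.radius ^ p) : w ∉ futurePart Ω t₀ := by
  rw [abs_lt] at h2
  have := Real.rpow_nonneg R.radius_pos.le p
  intro h
  linarith [h.2]

lemma radius_le_parabolicInfDist (hp : 1 ≤ p)
    (hR : (R.dilate (A 2) (A.pos 2)).hull p 3 ⊆ Ω) (hRf : R.set p ⊆ futurePart Ω t₀)
    {z : SpaceTime n} (hz : z ∈ (R.plus p).set p) :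
    R.radius ≤ parabolicInfDist p z (futurePart Ω t₀)ᶜ := by
  have hp0 : 0 < p := by linarith
  have hr := R.radius_pos
  have hrp : 0 < R.radius ^ p := by positivity
  have ht : t₀ < R.center.2 := by
    refine (hRf ((R.mem_set_iff hp0 R.center).2 ?_)).2
    simp [hr, hrp]
  obtain ⟨h1, h2⟩ := ((R.plus p).mem_set_iff hp0 z).1 hz
  simp only [Cylinder.plus, Cylinder.lag, abs_lt] at h1 h2
  refine le_parabolicInfDist_compl hp0 (futurePart_compl_nonempty Ω t₀) hr ?_
  intro v hv1 hv2
  rw [abs_lt] at hv2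
  have := norm_sub_le_norm_sub_add_norm_sub v.1 z.1 R.center.1
  apply mem_futurePart_of_above hp hR ht <;> linarith

end Hole

/-! ### Chains as sequences, and their good scales -/

lemma exists_seq_of_mem_fitChains {p : ℝ} {Ω : Set (SpaceTime n)} {A : FITParam} {P Q : Cylinder n}
    {C : List (Cylinder n)} (hC : C ∈ fitChains p Ω A P Q) :
    ∃ (N : ℕ) (c : ℕ → Cylinder n), C.length = N + 1 ∧ c 0 = P ∧ c N = Q ∧
      (∀ j < N, IsFITLink p (A 0) (A 1) (c j) (c (j + 1))) ∧
      ∀ j ≤ N, ((c j).dilate (A 2) (A.pos 2)).hull p 3 ⊆ Ω := by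
  obtain ⟨h1, h2, h3, h4⟩ := hC
  have hne : C ≠ [] := by
    rintro rfl
    simp at h1
  have hlen : 0 < C.length := List.length_pos_iff.2 hne
  -- The default value `P` is never read at indices up to `N = C.length - 1`.
  refine ⟨C.length - 1, fun j => C.getD j P, by omega, ?_, ?_, ?_, ?_⟩
  · simp [List.getD_eq_getElem?_getD, ← List.head?_eq_getElem?, h1]
  · simp [List.getD_eq_getElem?_getD, ← List.getLast?_eq_getElem?, h2]
  · intro j hj
    beta_reduce
    rw [List.getD_eq_getElem _ _ (by omega), List.getD_eq_getElem _ _ (by omega)]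
    exact List.isChain_iff_getElem.1 h3 j (by omega)
  · intro j hj
    beta_reduce
    rw [List.getD_eq_getElem _ _ (by omega)]
    exact h4 _ (List.getElem_mem _)

lemma IsFITHolder.exists_chain {p t₀ : ℝ} {A : FITParam} {Ω : Set (SpaceTime n)} (hp : 0 < p)
    (hΩ : IsFITHolder p t₀ A Ω) :
    ∃ (Rs : Cylinder n) (K : ℝ), 0 < K ∧ Rs.center.2 < t₀ ∧ ∀ z ∈ futurePart Ω t₀,
      ∃ (N : ℕ) (c : ℕ → Cylinder n), c 0 = Rs ∧ z ∈ ((c N).plus p).set p ∧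
        (c N).set p ⊆ futurePart Ω t₀ ∧
        (∀ j < N, IsFITLink p (A 0) (A 1) (c j) (c (j + 1))) ∧
        (∀ j ≤ N, ((c j).dilate (A 2) (A.pos 2)).hull p 3 ⊆ Ω) ∧
        (N : ℝ) + 1 ≤ K * Real.logb 2 (1 + 1 / parabolicInfDist p z (futurePart Ω t₀)ᶜ) := by
  obtain ⟨-, Rs, hconn, K, hK, H⟩ := hΩ
  refine ⟨Rs, K, hK, ?_, ?_⟩
  · refine (hconn.1 ((Rs.mem_set_iff hp Rs.center).2 ?_)).2
    have hr := Rs.radius_pos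
    have hrp : 0 < Rs.radius ^ p := by positivity
    simp [hr, hrp]
  intro z hz
  have hle := H z hz
  set X : ℕ∞ := ⨅ (Q : Cylinder n) (_ : z ∈ (Q.plus p).set p ∧ Q.set p ⊆ futurePart Ω t₀),
    fitDist p Ω A Rs Q with hX
  have hXtop : X ≠ ⊤ := by
    intro h
    rw [h] at hle
    exact absurd (hle.trans_lt ENNReal.ofReal_lt_top) (by simp)
  obtain ⟨q, hq⟩ := ENat.ne_top_iff_exists.1 hXtop
  have hlt : X < ((q + 1 : ℕ) : ℕ∞) := by
    rw [← hq]
    exact_mod_cast Nat.lt_succ_self q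
  rw [hX] at hlt
  simp only [fitDist, iInf_lt_iff] at hlt
  obtain ⟨Q, ⟨hzQ, hQ⟩, C, hC, hlen⟩ := hlt
  obtain ⟨N, c, hN, h0, hcN, hlink, hhull⟩ := exists_seq_of_mem_fitChains hC
  have hNq : N + 1 ≤ q := by
    rw [hN] at hlen
    have : N + 1 < q + 1 := by exact_mod_cast hlen
    omega
  refine ⟨N, c, h0, hcN ▸ hzQ, hcN ▸ hQ, hlink, hhull, ?_⟩
  rw [← hq] at hle
  have hle' : (q : ℝ≥0∞) ≤ ENNReal.ofReal
      (K * Real.logb 2 (1 + 1 / parabolicInfDist p z (futurePart Ω t₀)ᶜ)) := by exact_mod_cast hle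
  -- Since `q ≥ N + 1 > 0`, the truncation in `ENNReal.ofReal` is harmless.
  rw [ENNReal.natCast_le_ofReal (by omega)] at hle'
  refine le_trans ?_ hle'
  exact_mod_cast hNq

/-- Telescoping back from `N`: each size enters two consecutive steps, except the one at `j`, which
enters only once. -/
lemma norm_sub_le_sum_Ico {E : Type*} [SeminormedAddCommGroup E] (f : ℕ → E) (ρ : ℕ → ℝ) (b : ℝ)
    (N : ℕ) (z : E) (hz : ‖z - f N‖ ≤ b * ρ N)
    (hf : ∀ j < N, ‖f j - f (j + 1)‖ ≤ b * (ρ j + ρ (j + 1))) {j : ℕ} (hj : j ≤ N) :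
    ‖z - f j‖ ≤ 2 * b * ∑ l ∈ Finset.Ico j (N + 1), ρ l - b * ρ j := by
  induction hj using Nat.decreasingInduction with
  | self =>
    simp only [Finset.sum_Ico_succ_top le_rfl, Finset.Ico_self, Finset.sum_empty]
    linarith
  | of_succ j hj ih =>
    rw [Finset.sum_eq_sum_Ico_succ_bot (by omega)]
    have h1 := hf j (by omega)
    have h2 := norm_sub_le_norm_sub_add_norm_sub z (f (j + 1)) (f j)
    rw [norm_sub_rev (f (j + 1))] at h2
    linarith

/-- The two bounds are proved together: the second controls the sum while terms are active, the
first persists once they vanish. -/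
lemma sum_two_pow_mul_le (r : ℝ) (hr : 0 ≤ r) (k : ℕ) :
    (∑ i ∈ Finset.range k, if 2 ^ i * r < 1 then 2 ^ i * r else 0) ≤ 2 ∧
    (∑ i ∈ Finset.range k, if 2 ^ i * r < 1 then 2 ^ i * r else 0) ≤ 2 ^ k * r := by
  induction k with
  | zero => simpa using hr
  | succ k ih =>
    rw [Finset.sum_range_succ, pow_succ]
    have : 0 ≤ 2 ^ k * r := by positivity
    split_ifs with h
    · constructor <;> linarith [ih.2]
    · constructor <;> linarith [ih.1, ih.2]

/-- Along a sequence of `N + 1` positive numbers which descends to `2⁻ᵏ`, at most `2 (N + 1) / C` scales `i`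
have a tail below `2⁻ⁱ` with sum more than `C 2⁻ⁱ`. -/
lemma exists_good_scales (r : ℕ → ℝ) (hr : ∀ j, 0 < r j) (N b k : ℕ) (C : ℝ) (hC : 0 < C)
    (h0 : ((2 : ℝ) ^ b)⁻¹ ≤ r 0) (hN : r N ≤ ((2 : ℝ) ^ k)⁻¹) :
    ∃ G ⊆ Finset.Ico b k, (k : ℝ) - b - 2 * (N + 1) / C ≤ G.card ∧
      ∀ i ∈ G, ∃ j < N, ((2 : ℝ) ^ i)⁻¹ ≤ r j ∧
        (∀ l, j < l → l ≤ N → r l ≤ ((2 : ℝ) ^ i)⁻¹) ∧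
        ∑ l ∈ Finset.Ico (j + 1) (N + 1), r l ≤ C * ((2 : ℝ) ^ i)⁻¹ := by
  -- The last index with radius at least `2⁻ⁱ`; it is not `N` because `r N ≤ 2⁻ᵏ < 2⁻ⁱ`.
  have hlast : ∀ i ∈ Finset.Ico b k, ∃ j < N, ((2 : ℝ) ^ i)⁻¹ ≤ r j ∧
      ∀ l, j < l → l ≤ N → r l < ((2 : ℝ) ^ i)⁻¹ := by
    intro i hi
    rw [Finset.mem_Ico] at hi
    set S := {j ∈ Finset.range (N + 1) | ((2 : ℝ) ^ i)⁻¹ ≤ r j} with hS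
    have hne : S.Nonempty := by
      refine ⟨0, Finset.mem_filter.2 ⟨by simp, le_trans ?_ h0⟩⟩
      gcongr
      · exact one_le_two
      · exact hi.1
    have hmem := Finset.mem_filter.1 (S.max'_mem hne)
    rw [Finset.mem_range] at hmem
    refine ⟨S.max' hne, ?_, hmem.2, ?_⟩
    · refine lt_of_le_of_ne (by omega) fun h => ?_
      have h1 := hmem.2
      rw [h] at h1
      have h2 : ((2 : ℝ) ^ k)⁻¹ < ((2 : ℝ) ^ i)⁻¹ := by
        gcongr
        · exact one_lt_two
        · exact hi.2
      linarith
    · intro l hl hlN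
      by_contra! hcon
      have := S.le_max' l (Finset.mem_filter.2 ⟨Finset.mem_range.2 (by omega), hcon⟩)
      omega
  choose! J hJN hJ1 hJ2 using hlast
  set T : ℕ → ℝ := fun i => ∑ l ∈ Finset.Ico (J i + 1) (N + 1), r l with hT
  have hTnonneg : ∀ i, 0 ≤ T i := fun i => Finset.sum_nonneg fun l _ => (hr l).le
  set G := {i ∈ Finset.Ico b k | T i ≤ C * ((2 : ℝ) ^ i)⁻¹} with hG
  set B := {i ∈ Finset.Ico b k | ¬ T i ≤ C * ((2 : ℝ) ^ i)⁻¹} with hB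
  have hsum : ∑ i ∈ Finset.Ico b k, 2 ^ i * T i ≤ 2 * (N + 1) := by
    calc ∑ i ∈ Finset.Ico b k, 2 ^ i * T i
        ≤ ∑ i ∈ Finset.Ico b k, ∑ l ∈ Finset.range (N + 1),
            if 2 ^ i * r l < 1 then 2 ^ i * r l else 0 := by
          refine Finset.sum_le_sum fun i hi => ?_
          rw [hT, Finset.mul_sum]
          have hsub : Finset.Ico (J i + 1) (N + 1) ⊆ Finset.range (N + 1) := by
            intro l hl
            rw [Finset.mem_Ico] at hl
            exact Finset.mem_range.2 hl.2
          refine le_trans (Finset.sum_le_sum fun l hl => ?_)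
            (Finset.sum_le_sum_of_subset_of_nonneg hsub fun l _ _ => ?_)
          · rw [Finset.mem_Ico] at hl
            have h1 := hJ2 i hi l (by omega) (by omega)
            rw [← one_div, lt_div_iff₀' (by positivity)] at h1
            rw [if_pos h1]
          · have := hr l
            split_ifs <;> positivity
      _ ≤ ∑ i ∈ Finset.range k, ∑ l ∈ Finset.range (N + 1),
            if 2 ^ i * r l < 1 then 2 ^ i * r l else 0 := by
          refine Finset.sum_le_sum_of_subset_of_nonneg ?_ fun i _ _ => Finset.sum_nonneg fun l _ => ?_
          · intro i hi
            rw [Finset.mem_Ico] at hi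
            exact Finset.mem_range.2 hi.2
          · have := hr l
            split_ifs <;> positivity
      _ = ∑ l ∈ Finset.range (N + 1), ∑ i ∈ Finset.range k,
            if 2 ^ i * r l < 1 then 2 ^ i * r l else 0 := Finset.sum_comm
      _ ≤ ∑ _l ∈ Finset.range (N + 1), (2 : ℝ) :=
          Finset.sum_le_sum fun l _ => (sum_two_pow_mul_le (r l) (hr l).le k).1
      _ = 2 * (N + 1) := by simp [mul_comm]
  -- Markov's inequality: each bad scale contributes more than `C` to the double sum.
  have hBcard : C * B.card ≤ 2 * (N + 1) := by
    refine le_trans ?_ hsum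
    calc C * B.card = ∑ _i ∈ B, C := by simp [mul_comm]
      _ ≤ ∑ i ∈ B, 2 ^ i * T i := by
          refine Finset.sum_le_sum fun i hi => ?_
          have h1 := not_le.1 (Finset.mem_filter.1 hi).2
          have h2 : (0 : ℝ) < 2 ^ i := by positivity
          rw [← div_eq_mul_inv, div_lt_iff₀' h2] at h1
          exact h1.le
      _ ≤ _ := Finset.sum_le_sum_of_subset_of_nonneg (Finset.filter_subset _ _) fun i _ _ =>
          mul_nonneg (by positivity) (hTnonneg i)
  refine ⟨G, Finset.filter_subset _ _, ?_, ?_⟩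
  · have hcard : G.card + B.card = k - b := by
      rw [hG, hB, Finset.card_filter_add_card_filter_not, Nat.card_Ico]
    have h1 : (k : ℝ) - b ≤ G.card + B.card := by
      have : k ≤ G.card + B.card + b := by omega
      have : (k : ℝ) ≤ G.card + B.card + b := by exact_mod_cast this
      linarith
    have h2 : (B.card : ℝ) ≤ 2 * (N + 1) / C := by rwa [le_div_iff₀' hC]
    linarith
  · intro i hi
    have hi' := Finset.mem_filter.1 hi
    exact ⟨J i, hJN i hi'.1, hJ1 i hi'.1, fun l h1 h2 => (hJ2 i hi'.1 l h1 h2).le, hi'.2⟩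

/-! ### Geometry along a chain -/

section Chain

variable {p t₀ : ℝ} {A : FITParam} {Ω : Set (SpaceTime n)} {N : ℕ} {c : ℕ → Cylinder n}
  {z : SpaceTime n}

lemma chain_distance (hp : 0 < p) (hz : z ∈ ((c N).plus p).set p)
    (hlink : ∀ j < N, IsFITLink p (A 0) (A 1) (c j) (c (j + 1))) {j : ℕ} (hj : j ≤ N) :
    ‖z.1 - (c j).center.1‖ ≤ 2 * ∑ l ∈ Finset.Ico j (N + 1), (c l).radius ∧
    |z.2 - (c j).center.2| ≤ 8 * ∑ l ∈ Finset.Ico j (N + 1), (c l).radius ^ p := by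
  obtain ⟨h1, h2⟩ := (Cylinder.mem_set_iff hp _ z).1 hz
  simp only [Cylinder.plus, Cylinder.lag, abs_lt] at h1 h2
  have hpow : ∀ l, 0 < (c l).radius ^ p := fun l => Real.rpow_pos_of_pos (c l).radius_pos p
  constructor
  · have := norm_sub_le_sum_Ico (fun l => (c l).center.1) (fun l => (c l).radius) 1 N z.1
      (by rw [one_mul]; exact h1.le)
      (fun j hj => by rw [one_mul]; exact ((hlink j hj).bounds hp (A.pos 1)).1) hj
    have hr := (c j).radius_pos
    linarith
  · have := norm_sub_le_sum_Ico (fun l => (c l).center.2) (fun l => (c l).radius ^ p) 4 N z.2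
      (by
        rw [Real.norm_eq_abs, abs_le]
        constructor <;> linarith [hpow N])
      (fun j hj => by
        obtain ⟨-, h3, h4⟩ := (hlink j hj).bounds hp (A.pos 1)
        rw [Real.norm_eq_abs, abs_le]
        constructor <;> linarith [hpow j, hpow (j + 1)]) hj
    rw [Real.norm_eq_abs] at this
    have hr := hpow j
    linarith

/-- After `t₀`, a cylinder yields a point whose distance to the complement is at least its radius,
hence at most `D`. Up to `t₀`, a later member has used at least `2 r ^ p` of the time available
since the start. -/
lemma chain_radius_le (hp : 1 ≤ p) {D : ℝ} (hD : 0 ≤ D)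
    (hmax : ∀ w ∈ futurePart Ω t₀, parabolicInfDist p w (futurePart Ω t₀)ᶜ ≤ D)
    (ht : (c 0).center.2 < t₀)
    (hlink : ∀ j < N, IsFITLink p (A 0) (A 1) (c j) (c (j + 1)))
    (hhull : ∀ j ≤ N, ((c j).dilate (A 2) (A.pos 2)).hull p 3 ⊆ Ω) {j : ℕ} (hj : j ≤ N) :
    (c j).radius ≤ (c 0).radius + D + (t₀ - (c 0).center.2) ^ (1 / p) := by
  have hp0 : 0 < p := by linarith
  have hr := (c j).radius_pos
  have hr0 := (c 0).radius_pos
  have hroot : 0 ≤ (t₀ - (c 0).center.2) ^ (1 / p) := Real.rpow_nonneg (by linarith) _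
  have hpow : ∀ l, 0 < (c l).radius ^ p := fun l => Real.rpow_pos_of_pos (c l).radius_pos p
  rcases lt_or_ge t₀ (c j).center.2 with h | h
  · obtain ⟨h1, h2⟩ := hole_of_center_gt hp (hhull j hj) h
      (w := ((c j).center.1, (c j).center.2 + 2 * (c j).radius ^ p))
      (by simpa using hr) (by simpa using hpow j)
    linarith [hmax _ h1]
  · rcases Nat.eq_zero_or_pos j with rfl | hj0
    · linarith
    have hmono : ∀ l ≤ N, (c 0).center.2 ≤ (c l).center.2 := by
      intro l hl
      induction l with
      | zero => exact le_rfl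
      | succ l ih =>
        have := ((hlink l hl).bounds hp0 (A.pos 1)).2.1
        linarith [ih (by omega), hpow l, hpow (l + 1)]
    obtain ⟨l, rfl⟩ : ∃ l, j = l + 1 := ⟨j - 1, by omega⟩
    have h1 := ((hlink l (by omega)).bounds hp0 (A.pos 1)).2.1
    have h2 := hmono l (by omega)
    have h3 : (c (l + 1)).radius ≤ (t₀ - (c 0).center.2) ^ (1 / p) := by
      rw [one_div, Real.le_rpow_inv_iff_of_pos hr.le (by linarith) hp0]
      linarith [hpow l, hpow (l + 1)]
    linarith

/-- At a scale `δ = 2⁻ⁱ` where the tail of the chain has size comparable to `δ`, the point reached by the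
chain has, at distance comparable to `δ`, a cylinder of radius `δ` on which the distance to the
boundary of the future part is at least `δ`, or which misses the future part. -/
lemma chain_hole (hp : 1 ≤ p) (hz : z ∈ ((c N).plus p).set p)
    (hlink : ∀ j < N, IsFITLink p (A 0) (A 1) (c j) (c (j + 1)))
    (hhull : ∀ j ≤ N, ((c j).dilate (A 2) (A.pos 2)).hull p 3 ⊆ Ω) {j : ℕ} (hj : j < N)
    {δ C : ℝ} (hδ : 0 < δ) (hC : 0 ≤ C) (h1 : δ ≤ (c j).radius)
    (h2 : ∀ l, j < l → l ≤ N → (c l).radius ≤ δ)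
    (h3 : ∑ l ∈ Finset.Ico (j + 1) (N + 1), (c l).radius ≤ C * δ) :
    ∃ h : SpaceTime n, ‖z.1 - h.1‖ ≤ (2 * A 0 + 10 * (A 0 : ℝ) ^ p + 8 * C) * δ ∧
      |z.2 - h.2| ≤ (2 * A 0 + 10 * (A 0 : ℝ) ^ p + 8 * C) * δ ^ p ∧
      ∀ w : SpaceTime n, ‖w.1 - h.1‖ < δ → |w.2 - h.2| < δ ^ p →
        w ∈ futurePart Ω t₀ → δ ≤ parabolicInfDist p w (futurePart Ω t₀)ᶜ := by
  have hp0 : 0 < p := by linarith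
  have hA : (2 : ℝ) ≤ A 0 := (A 0).2
  have hδp : 0 < δ ^ p := Real.rpow_pos_of_pos hδ p
  have hAp : 0 < (A 0 : ℝ) ^ p := Real.rpow_pos_of_pos (by linarith) p
  -- The next radius is at most `δ`, and one link shrinks radii by at most the factor `A₁`.
  have hrj : (c j).radius ≤ A 0 * δ :=
    ((hlink j hj).radius_le hp (by linarith)).trans
      (mul_le_mul_of_nonneg_left (h2 _ (by omega) (by omega)) (by linarith))
  have hrjp : (c j).radius ^ p ≤ (A 0 : ℝ) ^ p * δ ^ p := by
    rw [← Real.mul_rpow (by linarith) hδ.le]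
    exact Real.rpow_le_rpow (c j).radius_pos.le hrj hp0.le
  have hpos := Real.rpow_pos_of_pos (c j).radius_pos p
  -- Tail radii are at most `δ`, so `r ^ p ≤ r * δ ^ (p - 1)` transfers the length bound to time.
  have hsum : ∑ l ∈ Finset.Ico (j + 1) (N + 1), (c l).radius ^ p ≤ C * δ ^ p := by
    have hsplit : ∀ x : ℝ, 0 < x → x ^ p = x * x ^ (p - 1) := fun x hx => by
      rw [Real.rpow_sub_one hx.ne']
      field_simp
    calc ∑ l ∈ Finset.Ico (j + 1) (N + 1), (c l).radius ^ p
        ≤ ∑ l ∈ Finset.Ico (j + 1) (N + 1), (c l).radius * δ ^ (p - 1) := by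
          refine Finset.sum_le_sum fun l hl => ?_
          rw [Finset.mem_Ico] at hl
          rw [hsplit _ (c l).radius_pos]
          have hr := (c l).radius_pos
          refine mul_le_mul_of_nonneg_left ?_ hr.le
          exact Real.rpow_le_rpow hr.le (h2 l (by omega) (by omega)) (by linarith)
      _ ≤ C * δ * δ ^ (p - 1) := by
          rw [← Finset.sum_mul]
          gcongr
      _ = C * δ ^ p := by rw [hsplit δ hδ]; ring
  obtain ⟨d1, d2⟩ := chain_distance hp0 hz hlink hj.le
  rw [Finset.sum_eq_sum_Ico_succ_bot (by omega)] at d1 d2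
  have hd1 : ‖z.1 - (c j).center.1‖ ≤ (2 * A 0 + 10 * (A 0 : ℝ) ^ p + 8 * C) * δ := by
    have := mul_pos hAp hδ
    have := mul_nonneg hC hδ.le
    linarith
  have hδr : δ ^ p ≤ (c j).radius ^ p := Real.rpow_le_rpow hδ.le h1 hp0.le
  have hAδ : 0 ≤ A 0 * δ ^ p := mul_nonneg (by linarith) hδp.le
  rcases lt_or_ge t₀ (c j).center.2 with h | h
  · refine ⟨((c j).center.1, (c j).center.2 + 2 * (c j).radius ^ p), hd1, ?_, ?_⟩
    · rw [abs_le] at d2 ⊢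
      constructor <;> simp only <;> linarith
    · intro w hw1 hw2 _
      exact h1.trans (hole_of_center_gt hp (hhull j hj.le) h (hw1.trans_le h1)
        (hw2.trans_le hδr)).2
  · refine ⟨((c j).center.1, (c j).center.2 - 2 * (c j).radius ^ p), hd1, ?_, ?_⟩
    · rw [abs_le] at d2 ⊢
      constructor <;> simp only <;> linarith
    · intro w hw1 hw2 hw
      exact absurd hw (hole_of_center_le h (hw2.trans_le hδr))

end Chain

/-! ### Elementary estimates and the decay of the layers -/

lemma exists_pow_mul_pow_le (d : ℕ) {γ : ℝ} (h0 : 0 < γ) (h1 : γ < 1) :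
    ∃ D α : ℝ, 0 < D ∧ 0 < α ∧ ∀ k : ℕ,
      ((k : ℝ) + 2) ^ d * γ ^ k ≤ D * (2 : ℝ) ^ (-α * (k : ℝ)) := by
  -- Write `γ ^ k = s ^ k * s ^ k`: one factor absorbs the polynomial, the other supplies the decay.
  set s := √γ with hs
  have hs0 : 0 < s := Real.sqrt_pos.2 h0
  have hs1 : s < 1 := by rw [hs, Real.sqrt_lt' one_pos]; simpa using h1
  have hss : s * s = γ := Real.mul_self_sqrt h0.le
  have hbdd := (tendsto_pow_const_mul_const_pow_of_abs_lt_one d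
    (by rwa [abs_of_pos hs0] : |s| < 1)).bddAbove_range
  obtain ⟨B, hB⟩ := hbdd
  refine ⟨(|B| + 1) / s ^ 2, -Real.logb 2 s, by positivity, ?_, fun k => ?_⟩
  · exact neg_pos.2 (Real.logb_neg one_lt_two hs0 hs1)
  · have hk := hB ⟨k + 2, rfl⟩
    simp only at hk
    rw [neg_neg, Real.rpow_mul zero_le_two, Real.rpow_logb two_pos (by norm_num) hs0,
      Real.rpow_natCast, div_mul_eq_mul_div, le_div_iff₀ (by positivity), ← hss, mul_pow]
    calc ((k : ℝ) + 2) ^ d * (s ^ k * s ^ k) * s ^ 2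
        = (((k + 2 : ℕ) : ℝ) ^ d * s ^ (k + 2)) * s ^ k := by push_cast; ring
      _ ≤ (|B| + 1) * s ^ k := by
          gcongr
          linarith [le_abs_self B]

/-- Every chain has at least one member, so the logarithmic bound keeps points of the future part
within a fixed distance of its complement. -/
lemma one_le_mul_logb_imp {K x : ℝ} (hK : 0 < K) (hx : 0 < x)
    (h : 1 ≤ K * Real.logb 2 (1 + 1 / x)) : x ≤ 1 / ((2 : ℝ) ^ (1 / K) - 1) := by
  have h1 : 1 / K ≤ Real.logb 2 (1 + 1 / x) := by rwa [div_le_iff₀' hK]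
  rw [Real.le_logb_iff_rpow_le one_lt_two (by positivity)] at h1
  have h2 : 1 < (2 : ℝ) ^ (1 / K) := Real.one_lt_rpow one_lt_two (by positivity)
  rw [le_div_iff₀ (by linarith), ← le_div_iff₀' hx]
  linarith

lemma logb_one_add_inv_le {x : ℝ} (k : ℕ) (hx : ((2 : ℝ) ^ (k + 1))⁻¹ < x) :
    Real.logb 2 (1 + 1 / x) ≤ k + 2 := by
  have hx0 : 0 < x := lt_trans (by positivity) hx
  have h1 : 1 / x ≤ 2 ^ (k + 1) := by
    rw [one_div]
    exact ((inv_lt_comm₀ (by positivity) hx0).1 hx).le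
  rw [Real.logb_le_iff_le_rpow one_lt_two (by positivity)]
  have : (2 : ℝ) ^ ((k : ℝ) + 2) = 2 ^ (k + 1) * 2 := by
    rw [← pow_succ, ← Real.rpow_natCast]
    push_cast
    ring_nf
  rw [this]
  linarith [one_le_pow₀ (one_le_two : (1 : ℝ) ≤ 2) (n := k + 1)]

lemma parabolicInfDist_nonneg (p : ℝ) (z : SpaceTime n) (S : Set (SpaceTime n)) :
    0 ≤ parabolicInfDist p z S := by
  refine Real.sInf_nonneg ?_
  rintro _ ⟨w, -, rfl⟩
  exact (norm_nonneg _).trans (le_max_left _ _)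

lemma outerLayer_eq (p t₀ : ℝ) (Ω : Set (SpaceTime n)) (k : ℕ) :
    outerLayer p t₀ Ω k = {z | z ∈ futurePart Ω t₀ ∧
      ((2 : ℝ) ^ (k + 1))⁻¹ < parabolicInfDist p z (futurePart Ω t₀)ᶜ ∧
      parabolicInfDist p z (futurePart Ω t₀)ᶜ ≤ ((2 : ℝ) ^ k)⁻¹} := by
  have h : (-(k : ℤ) - 1) = -((k + 1 : ℕ) : ℤ) := by push_cast; ring
  rw [outerLayer, h, zpow_neg, zpow_neg, zpow_natCast, zpow_natCast]

/-- The two consequences of the FIT Hölder condition used for the measure estimates: the points at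
distance more than `2⁻⁽ᵏ⁺¹⁾` from the boundary lie in a box of size `O(k + 2)`, and points of the outer layer
see holes at most scales. -/
lemma IsFITHolder.exists_box_and_holes {p t₀ : ℝ} {A : FITParam} {Ω : Set (SpaceTime n)}
    (hp : 1 ≤ p) (hΩ : IsFITHolder p t₀ A Ω) :
    ∃ M C : ℝ, ∃ b : ℕ, 0 < M ∧
      (∀ k : ℕ, ∀ z ∈ futurePart Ω t₀,
        ((2 : ℝ) ^ (k + 1))⁻¹ < parabolicInfDist p z (futurePart Ω t₀)ᶜ →
        (∀ l, |z.1 l| ≤ M * (k + 2)) ∧ |z.2| ≤ M * (k + 2)) ∧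
      ∀ b' k : ℕ, b ≤ b' → ∀ z ∈ outerLayer p t₀ Ω k, ∃ G ⊆ Finset.Ico b' k,
        (k : ℝ) - b' - (k + 2) / 4 ≤ G.card ∧ ∀ i ∈ G, ∃ h : SpaceTime n,
          ‖z.1 - h.1‖ ≤ C * ((2 : ℝ) ^ i)⁻¹ ∧ |z.2 - h.2| ≤ C * ((2 : ℝ) ^ i)⁻¹ ^ p ∧
          ∀ w : SpaceTime n, ‖w.1 - h.1‖ < ((2 : ℝ) ^ i)⁻¹ → |w.2 - h.2| < ((2 : ℝ) ^ i)⁻¹ ^ p →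
            w ∉ outerLayer p t₀ Ω k := by
  have hp0 : 0 < p := by linarith
  obtain ⟨Rs, K, hK, ht, H⟩ := hΩ.exists_chain hp0
  set D := 1 / ((2 : ℝ) ^ (1 / K) - 1) with hD
  have hD0 : 0 ≤ D := by
    have : 1 < (2 : ℝ) ^ (1 / K) := Real.one_lt_rpow one_lt_two (by positivity)
    exact div_nonneg zero_le_one (by linarith)
  have hmax : ∀ w ∈ futurePart Ω t₀, parabolicInfDist p w (futurePart Ω t₀)ᶜ ≤ D := by
    intro w hw
    obtain ⟨N, c, -, -, -, -, -, hN⟩ := H w hw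
    rcases (parabolicInfDist_nonneg p w (futurePart Ω t₀)ᶜ).eq_or_lt with h | h
    · rwa [← h]
    · refine one_le_mul_logb_imp hK h (le_trans ?_ hN)
      linarith [Nat.cast_nonneg (α := ℝ) N]
  have hcount : ∀ (k N : ℕ) (z : SpaceTime n),
      ((2 : ℝ) ^ (k + 1))⁻¹ < parabolicInfDist p z (futurePart Ω t₀)ᶜ →
      (N : ℝ) + 1 ≤ K * Real.logb 2 (1 + 1 / parabolicInfDist p z (futurePart Ω t₀)ᶜ) →
      (N : ℝ) + 1 ≤ K * (k + 2) := fun k N z hz hN =>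
    hN.trans (mul_le_mul_of_nonneg_left (logb_one_add_inv_le k hz) hK.le)
  set R := Rs.radius + D + (t₀ - Rs.center.2) ^ (1 / p) with hR
  have hroot : 0 ≤ (t₀ - Rs.center.2) ^ (1 / p) := Real.rpow_nonneg (by linarith) _
  have hR0 : 0 < R := by linarith [Rs.radius_pos]
  -- Scales from `b` on lie below the radius of the central cylinder, where every chain starts.
  obtain ⟨b, hb⟩ := exists_pow_lt_of_lt_one Rs.radius_pos (by norm_num : (2 : ℝ)⁻¹ < 1)
  rw [inv_pow] at hb
  refine ⟨‖Rs.center.1‖ + |Rs.center.2| + 2 * K * R + 8 * K * R ^ p,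
    2 * A 0 + 10 * (A 0 : ℝ) ^ p + 8 * (8 * K), b, by positivity, ?_, ?_⟩
  · intro k z hz hdist
    obtain ⟨N, c, h0, hzN, -, hlink, hhull, hN⟩ := H z hz
    have hNk := hcount k N z hdist hN
    have hrad : ∀ j ≤ N, (c j).radius ≤ R := by
      intro j hj
      have := chain_radius_le hp hD0 hmax (by rwa [h0]) hlink hhull hj
      rwa [h0] at this
    obtain ⟨d1, d2⟩ := chain_distance hp0 hzN hlink (Nat.zero_le N)
    rw [h0] at d1 d2
    have e1 : ∑ l ∈ Finset.Ico 0 (N + 1), (c l).radius ≤ K * (k + 2) * R := by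
      calc _ ≤ ∑ _l ∈ Finset.Ico 0 (N + 1), R := Finset.sum_le_sum fun l hl =>
            hrad l (by rw [Finset.mem_Ico] at hl; omega)
        _ = (N + 1) * R := by simp
        _ ≤ _ := by gcongr
    have e2 : ∑ l ∈ Finset.Ico 0 (N + 1), (c l).radius ^ p ≤ K * (k + 2) * R ^ p := by
      calc _ ≤ ∑ _l ∈ Finset.Ico 0 (N + 1), R ^ p := Finset.sum_le_sum fun l hl =>
            Real.rpow_le_rpow (c l).radius_pos.le
              (hrad l (by rw [Finset.mem_Ico] at hl; omega)) hp0.le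
        _ = (N + 1) * R ^ p := by simp
        _ ≤ _ := by gcongr
    have hk2 : (1 : ℝ) ≤ k + 2 := by linarith [Nat.cast_nonneg (α := ℝ) k]
    have f1 : ‖Rs.center.1‖ ≤ ‖Rs.center.1‖ * (k + 2) := le_mul_of_one_le_right (norm_nonneg _) hk2
    have f2 : |Rs.center.2| ≤ |Rs.center.2| * (k + 2) := le_mul_of_one_le_right (abs_nonneg _) hk2
    have f3 : 0 ≤ K * (k + 2) * R := by positivity
    have f4 : 0 ≤ K * (k + 2) * R ^ p := by positivity
    have f5 := norm_nonneg Rs.center.1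
    have f6 := abs_nonneg Rs.center.2
    constructor
    · intro l
      have g1 := PiLp.norm_apply_le z.1 l
      have g2 := norm_sub_norm_le z.1 Rs.center.1
      rw [Real.norm_eq_abs] at g1
      nlinarith
    · have g2 := abs_sub_abs_le_abs_sub z.2 Rs.center.2
      nlinarith
  · intro b' k hbb' z hz
    rw [outerLayer_eq] at hz
    obtain ⟨hzf, hz1, hz2⟩ := hz
    obtain ⟨N, c, h0, hzN, hcN, hlink, hhull, hN⟩ := H z hzf
    have hNk := hcount k N z hz1 hN
    -- The tail constant `8 K` makes the number of bad scales at most `2 (N + 1) / (8 K) ≤ (k + 2) /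
    -- 4`.
    obtain ⟨G, hGsub, hGcard, hG⟩ := exists_good_scales (fun j => (c j).radius)
      (fun j => (c j).radius_pos) N b' k (8 * K) (by positivity)
      (by
        rw [h0]
        refine le_trans ?_ hb.le
        gcongr
        exact one_le_two)
      ((radius_le_parabolicInfDist hp (hhull N le_rfl) hcN hzN).trans hz2)
    refine ⟨G, hGsub, le_trans ?_ hGcard, ?_⟩
    · have : 2 * ((N : ℝ) + 1) / (8 * K) ≤ (k + 2) / 4 := by
        rw [div_le_div_iff₀ (by positivity) (by norm_num)]
        linarith
      linarith
    · intro i hi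
      obtain ⟨j, hj, h1, h2, h3⟩ := hG i hi
      obtain ⟨h, hh1, hh2, hh3⟩ := chain_hole (t₀ := t₀) hp hzN hlink hhull hj
        (by positivity) (by positivity) h1 h2 h3
      refine ⟨h, hh1, hh2, fun w hw1 hw2 hw => ?_⟩
      rw [outerLayer_eq] at hw
      have hik := (Finset.mem_Ico.1 (hGsub hi)).2
      have : ((2 : ℝ) ^ k)⁻¹ < ((2 : ℝ) ^ i)⁻¹ := by
        gcongr
        exact one_lt_two
      linarith [hh3 w hw1 hw2 hw.1, hw.2.2]

/-- At least `k / 2 - e` scales carry a hole. Some grid among the `S` shifts sees at least the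
fraction `1 / S` of them, giving about `k / (2 S m)` factors `θ` against a box of volume `O((k + 2)
^ (n + 1))`. -/
lemma IsFITHolder.volume_outerLayer_le {p t₀ : ℝ} {A : FITParam} {Ω : Set (SpaceTime n)}
    (hp : 1 ≤ p) (hΩ : IsFITHolder p t₀ A Ω) :
    ∃ D α : ℝ, 0 < D ∧ 0 < α ∧
      ∀ k : ℕ, volume (outerLayer p t₀ Ω k) ≤ ENNReal.ofReal (D * (2 : ℝ) ^ (-α * (k : ℝ))) := by
  classical
  obtain ⟨M, C, b, hM, hbox, hhole⟩ := hΩ.exists_box_and_holes hp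
  obtain ⟨a, m, hm, hgrid⟩ := exists_hasHole_gridIndex n hp C
  obtain ⟨θ', hθ0', hθ1', hθ⟩ := exists_volume_many_holes_le n (zero_le_one.trans hp) m hm
  -- Positivity is needed for the negative real power of `θ` in the final constant.
  set θ := max θ' (1 / 2) with hθdef
  have hθ0 : 0 < θ := lt_max_of_lt_right (by norm_num)
  have hθ1 : θ < 1 := max_lt hθ1' (by norm_num)
  set S := Fintype.card ((Fin n → Bool) × Bool) with hS
  have hS0 : 0 < S := Fintype.card_pos
  set β := ((S : ℝ) * m)⁻¹ with hβ
  have hβ0 : 0 < β := by positivity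
  set e := (max b a : ℝ) + 1 with he
  set J : ℕ → ℕ := fun k => ⌊β * (k / 2 - e)⌋₊ with hJ
  have hcover : ∀ k, outerLayer p t₀ Ω k ⊆ ⋃ σ : (Fin n → Bool) × Bool,
      {z | z ∈ outerLayer p t₀ Ω k ∧ J k * m ≤ {l ∈ Finset.Ico 0 k |
        HasHole (gridIndex p σ) m (outerLayer p t₀ Ω k) l z}.card} := by
    intro k z hz
    obtain ⟨G, hGsub, hGcard, hG⟩ := hhole (max b a) k (le_max_left _ _) z hz
    have hGa : ∀ i ∈ G, a ≤ i ∧ i < k := fun i hi => by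
      have := Finset.mem_Ico.1 (hGsub hi)
      exact ⟨(le_max_right b a).trans this.1, this.2⟩
    have hsub : G.image (fun i => i - a) ⊆ Finset.univ.biUnion fun σ : (Fin n → Bool) × Bool =>
        {l ∈ Finset.Ico 0 k | HasHole (gridIndex p σ) m (outerLayer p t₀ Ω k) l z} := by
      intro l hl
      obtain ⟨i, hi, rfl⟩ := Finset.mem_image.1 hl
      obtain ⟨h, h1, h2, h3⟩ := hG i hi
      obtain ⟨σ, hσ⟩ := hgrid (outerLayer p t₀ Ω k) i z h (hGa i hi).1 h1 h2 h3
      refine Finset.mem_biUnion.2 ⟨σ, Finset.mem_univ _, Finset.mem_filter.2 ⟨?_, hσ⟩⟩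
      have := (hGa i hi).2
      rw [Finset.mem_Ico]
      omega
    have hinj : (G.image fun i => i - a).card = G.card := by
      refine Finset.card_image_of_injOn fun i hi j hj hij => ?_
      have h1 := (hGa i hi).1
      have h2 := (hGa j hj).1
      omega
    have hle : G.card ≤ ∑ σ : (Fin n → Bool) × Bool,
        {l ∈ Finset.Ico 0 k | HasHole (gridIndex p σ) m (outerLayer p t₀ Ω k) l z}.card := by
      rw [← hinj]
      exact (Finset.card_le_card hsub).trans Finset.card_biUnion_le
    have hJle : J k * m * S ≤ G.card := by
      rcases le_or_gt 0 (β * ((k : ℝ) / 2 - e)) with hpos | hneg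
      · have h1 : (J k : ℝ) ≤ β * (k / 2 - e) := Nat.floor_le hpos
        have h2 : (J k : ℝ) * m * S ≤ k / 2 - e := by
          calc (J k : ℝ) * m * S ≤ β * (k / 2 - e) * m * S := by gcongr
            _ = k / 2 - e := by rw [hβ]; field_simp
        have h3 : (J k : ℝ) * m * S ≤ G.card := by
          refine h2.trans (le_trans ?_ hGcard)
          have : (0 : ℝ) ≤ k := Nat.cast_nonneg k
          rw [he, Nat.cast_max]
          linarith
        exact_mod_cast h3
      · have : J k = 0 := Nat.floor_of_nonpos hneg.le
        rw [this]
        simp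
    have hex : ∃ σ ∈ (Finset.univ : Finset ((Fin n → Bool) × Bool)), J k * m ≤
        {l ∈ Finset.Ico 0 k | HasHole (gridIndex p σ) m (outerLayer p t₀ Ω k) l z}.card := by
      refine Finset.exists_le_of_sum_le Finset.univ_nonempty ?_
      rw [Finset.sum_const, Finset.card_univ, smul_eq_mul, mul_comm]
      exact hJle.trans hle
    obtain ⟨σ, -, hσ⟩ := hex
    exact Set.mem_iUnion.2 ⟨σ, hz, hσ⟩
  have hvol : ∀ k, volume (outerLayer p t₀ Ω k) ≤
      ENNReal.ofReal (S * (θ ^ J k * (2 * (M * (k + 2) + 1)) ^ (n + 1))) := by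
    intro k
    calc volume (outerLayer p t₀ Ω k) ≤ ∑ σ : (Fin n → Bool) × Bool,
          volume {z | z ∈ outerLayer p t₀ Ω k ∧ J k * m ≤ {l ∈ Finset.Ico 0 k |
            HasHole (gridIndex p σ) m (outerLayer p t₀ Ω k) l z}.card} :=
          (measure_mono (hcover k)).trans (measure_iUnion_fintype_le _ _)
      _ ≤ ∑ _σ : (Fin n → Bool) × Bool,
          ENNReal.ofReal (θ ^ J k * (2 * (M * (k + 2) + 1)) ^ (n + 1)) := by
          refine Finset.sum_le_sum fun σ _ => ?_
          refine (hθ σ _ (M * (k + 2)) k (J k) ?_).trans ?_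
          · intro z hz
            rw [outerLayer_eq] at hz
            exact hbox k z hz.1 hz.2.1
          · rw [← ENNReal.ofReal_pow hθ0', ← ENNReal.ofReal_pow (by positivity),
              ← ENNReal.ofReal_mul (by positivity)]
            refine ENNReal.ofReal_le_ofReal ?_
            gcongr
            exact le_max_left _ _
      _ = _ := by
          rw [Finset.sum_const, Finset.card_univ, nsmul_eq_mul,
            ENNReal.ofReal_mul (p := (S : ℝ)) (by positivity),
            ENNReal.ofReal_natCast]
  have hγ0 : 0 < θ ^ (β / 2) := Real.rpow_pos_of_pos hθ0 _
  have hγ1 : θ ^ (β / 2) < 1 := Real.rpow_lt_one hθ0.le hθ1 (by positivity)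
  obtain ⟨D, α, hD, hα, hDα⟩ := exists_pow_mul_pow_le (n + 1) hγ0 hγ1
  have hE : 0 < S * (θ ^ (-(β * e + 1)) * (2 * (M + 1)) ^ (n + 1)) := by
    have := Real.rpow_pos_of_pos hθ0 (-(β * e + 1))
    have : (0 : ℝ) < S := by exact_mod_cast hS0
    positivity
  refine ⟨S * (θ ^ (-(β * e + 1)) * (2 * (M + 1)) ^ (n + 1)) * D, α, by positivity, hα,
    fun k => (hvol k).trans (ENNReal.ofReal_le_ofReal ?_)⟩
  have hpowJ : θ ^ J k ≤ θ ^ (-(β * e + 1)) * (θ ^ (β / 2)) ^ k := by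
    rw [← Real.rpow_natCast, ← Real.rpow_natCast (θ ^ (β / 2)), ← Real.rpow_mul hθ0.le,
      ← Real.rpow_add hθ0]
    refine Real.rpow_le_rpow_of_exponent_ge hθ0 hθ1.le ?_
    have := (Nat.lt_floor_add_one (β * ((k : ℝ) / 2 - e))).le
    simp only [hJ]
    linarith
  have hbase : 2 * (M * ((k : ℝ) + 2) + 1) ≤ 2 * (M + 1) * (k + 2) := by
    linarith [Nat.cast_nonneg (α := ℝ) k]
  calc S * (θ ^ J k * (2 * (M * ((k : ℝ) + 2) + 1)) ^ (n + 1))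
      ≤ S * ((θ ^ (-(β * e + 1)) * (θ ^ (β / 2)) ^ k) * (2 * (M + 1) * (k + 2)) ^ (n + 1)) := by
        gcongr
    _ = S * (θ ^ (-(β * e + 1)) * (2 * (M + 1)) ^ (n + 1)) *
        (((k : ℝ) + 2) ^ (n + 1) * (θ ^ (β / 2)) ^ k) := by
        rw [mul_pow _ ((k : ℝ) + 2)]
        ring
    _ ≤ S * (θ ^ (-(β * e + 1)) * (2 * (M + 1)) ^ (n + 1)) * (D * 2 ^ (-α * (k : ℝ))) :=
        mul_le_mul_of_nonneg_left (hDα k) hE.le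
    _ = _ := by ring

lemma futurePart_subset_iUnion_outerLayer (p t₀ : ℝ) (Ω : Set (SpaceTime n))
    (hpos : ∀ z ∈ futurePart Ω t₀, 0 < parabolicInfDist p z (futurePart Ω t₀)ᶜ) :
    futurePart Ω t₀ ⊆ (⋃ k, outerLayer p t₀ Ω k) ∪
      {z | z ∈ futurePart Ω t₀ ∧ 1 < parabolicInfDist p z (futurePart Ω t₀)ᶜ} := by
  intro z hz
  rcases lt_or_ge 1 (parabolicInfDist p z (futurePart Ω t₀)ᶜ) with h | h
  · exact Or.inr ⟨hz, h⟩
  · obtain ⟨k, h1, h2⟩ := exists_nat_pow_near_of_lt_one (hpos z hz) h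
      (by norm_num : (0 : ℝ) < 2⁻¹) (by norm_num)
    refine Or.inl (Set.mem_iUnion.2 ⟨k, ?_⟩)
    rw [outerLayer_eq]
    rw [inv_pow] at h1 h2
    exact ⟨hz, h1, h2⟩

/-- At distance zero the convention `1 / 0 = 0` makes the logarithmic bound vanish, which no
nonempty chain satisfies. -/
lemma IsFITHolder.parabolicInfDist_pos {p t₀ : ℝ} {A : FITParam} {Ω : Set (SpaceTime n)}
    (hp : 0 < p) (hΩ : IsFITHolder p t₀ A Ω) {z : SpaceTime n} (hz : z ∈ futurePart Ω t₀) :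
    0 < parabolicInfDist p z (futurePart Ω t₀)ᶜ := by
  obtain ⟨Rs, K, hK, ht, H⟩ := hΩ.exists_chain hp
  obtain ⟨N, c, -, -, -, -, -, hN⟩ := H z hz
  refine (parabolicInfDist_nonneg p z (futurePart Ω t₀)ᶜ).lt_of_ne fun h => ?_
  rw [← h] at hN
  simp only [div_zero, add_zero, Real.logb_one, mul_zero] at hN
  linarith [Nat.cast_nonneg (α := ℝ) N]

theorem mainTheorem4 (n : ℕ) (hn : 1 ≤ n) (p : ℝ) (hp : 1 < p) (A : FITParam) (t₀ : ℝ)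
    (Ω : Set (SpaceTime n)) (hΩ : IsFITHolder p t₀ A Ω) :
    (∃ D α : ℝ, 0 < D ∧ 0 < α ∧
      ∀ k : ℕ, volume (outerLayer p t₀ Ω k) ≤ ENNReal.ofReal (D * (2 : ℝ) ^ (-α * (k : ℝ)))) ∧
    volume (futurePart Ω t₀) < ⊤ := by
  have hlayer := hΩ.volume_outerLayer_le hp.le
  refine ⟨hlayer, ?_⟩
  obtain ⟨D, α, hD, hα, hk⟩ := hlayer
  obtain ⟨M, -, -, hM, hbox, -⟩ := hΩ.exists_box_and_holes hp.le
  refine (measure_mono (futurePart_subset_iUnion_outerLayer p t₀ Ω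
    fun z hz => hΩ.parabolicInfDist_pos (by linarith) hz)).trans_lt (measure_union_lt_top ?_ ?_)
  · refine ((measure_iUnion_le _).trans (ENNReal.tsum_le_tsum hk)).trans_lt ?_
    have hq1 : (2 : ℝ) ^ (-α) < 1 := Real.rpow_lt_one_of_one_lt_of_neg one_lt_two (by linarith)
    have hq0 : 0 < (2 : ℝ) ^ (-α) := Real.rpow_pos_of_pos two_pos _
    have hsum : Summable fun k : ℕ => D * (2 : ℝ) ^ (-α * (k : ℝ)) := by
      refine Summable.mul_left D ?_
      simp only [Real.rpow_mul zero_le_two, Real.rpow_natCast]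
      exact summable_geometric_of_lt_one hq0.le hq1
    rw [← ENNReal.ofReal_tsum_of_nonneg (fun k => by positivity) hsum]
    exact ENNReal.ofReal_lt_top
  -- Distance more than `1` exceeds `1/2`, so the box for `k = 0` contains these points.
  · refine (measure_mono ?_).trans_lt (b := volume {z : SpaceTime n |
      (∀ l, |z.1 l| ≤ M * ((0 : ℕ) + 2)) ∧ |z.2| ≤ M * ((0 : ℕ) + 2)}) ?_
    · rintro z ⟨hz, hdist⟩
      refine hbox 0 z hz (lt_trans ?_ hdist)
      norm_num
    · rw [(volume_setOf_abs_le n _).2]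
      exact ENNReal.pow_lt_top ENNReal.ofReal_lt_top

end
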